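/- Let $N\ge 2$, let $\Omega\subset\mathbb{R}^N$ be a bounded domain of class $C^2$ (in particular, any bounded smooth domain), put $\delta(x)=\mathrm{dist}(x,\partial\Omega)$, $\Omega_\rho=\{x\in\Omega:\delta(x)<\rho\}$ for $\rho>0$, and let $\mu\le 1/4$. A *local sub-harmonic* is a function $u$ for which there is $\rho>0$ such that $u\in H^1_{loc}(\Omega_\rho)\cap C(\Omega_\rho)$ and $$\int_{\Omega_\rho}\nabla u\cdot\nabla\varphi\,dx-\int_{\Omega_\rho}\frac{\mu}{\delta^2}\,u\,\varphi\,dx\le 0\qquad\text{for all }0\le\varphi\in H^1_c(\Omega_\rho),$$ where $H^1_c(\Omega_\rho)$ is the set of functions in $H^1(\Omega_\rho)$ with compact support in $\Omega_\rho$. A *local super-harmonic* is defined in the same way with $\ge$; it is called positive if it is $>0$ in its set $\Omega_\rho$. A local sub-harmonic $u$ is called *large* if $\limsup_{x\to\partial\Omega}u(x)/h(x)>0$ for every positive local super-harmonic $h$, and *small* otherwise. A function $u$ *vanishes on* $\partial\Omega$ if $\lim_{x\to x_0,\,x\in\Omega}u(x)=0$ for every $x_0\in\partial\Omega$. Then the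 following hold. (i) If $u$ is a small local sub-harmonic, then its positive part $u_+=\max(u,0)$ vanishes on $\partial\Omega$. In particular, every small local sub-harmonic that is non-negative near $\partial\Omega$ vanishes on $\partial\Omega$. (ii) If $\mu<0$, then for every large local sub-harmonic $u$ there is a point $x_0\in\partial\Omega$ with $\limsup_{x\to x_0,\,x\in\Omega}u(x)=+\infty$. (iii) If $0<\mu\le 1/4$, then there exists a large local sub-harmonic which is positive near $\partial\Omega$ and vanishes on $\partial\Omega$. -/

import Mathlib

open MeasureTheory Filter Topology Set
open scoped ContDiff

/-- A bounded domain of class `C^2`: a bounded, non-empty, connected open set which near each of its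
boundary points is the sublevel set `{φ < 0}` of a `C^2` function with non-vanishing differential. -/
structure IsBoundedC2Domain {N : ℕ} (Ω : Set (EuclideanSpace ℝ (Fin N))) : Prop where
  isOpen : IsOpen Ω
  isConnected : IsConnected Ω
  isBounded : Bornology.IsBounded Ω
  boundary : ∀ x₀ ∈ frontier Ω, ∃ φ : EuclideanSpace ℝ (Fin N) → ℝ,
    ContDiffAt ℝ 2 φ x₀ ∧ fderiv ℝ φ x₀ ≠ 0 ∧ ∀ᶠ x in 𝓝 x₀, (x ∈ Ω ↔ φ x < 0)

/-- The distance `δ(x) = dist(x, ∂Ω)` to the boundary. -/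
noncomputable def bdryDist {N : ℕ} (Ω : Set (EuclideanSpace ℝ (Fin N)))
    (x : EuclideanSpace ℝ (Fin N)) : ℝ :=
  Metric.infDist x (frontier Ω)

/-- The parallel set `Ω_ρ = {x ∈ Ω : δ(x) < ρ}`. -/
noncomputable def parallelSet {N : ℕ} (Ω : Set (EuclideanSpace ℝ (Fin N))) (ρ : ℝ) :
    Set (EuclideanSpace ℝ (Fin N)) :=
  {x | x ∈ Ω ∧ bdryDist Ω x < ρ}

/-- The filter `x → ∂Ω`, i.e. `x ∈ Ω` and `δ(x) → 0`. -/
noncomputable def toBoundary {N : ℕ} (Ω : Set (EuclideanSpace ℝ (Fin N))) :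
    Filter (EuclideanSpace ℝ (Fin N)) :=
  comap (bdryDist Ω) (𝓝 0) ⊓ 𝓟 Ω

/-- `g` is the weak gradient of `u` in the open set `G`. -/
def HasWeakGradient {N : ℕ} (G : Set (EuclideanSpace ℝ (Fin N)))
    (u : EuclideanSpace ℝ (Fin N) → ℝ)
    (g : EuclideanSpace ℝ (Fin N) → EuclideanSpace ℝ (Fin N)) : Prop :=
  LocallyIntegrableOn u G ∧ LocallyIntegrableOn g G ∧
    ∀ ψ : EuclideanSpace ℝ (Fin N) → ℝ, ContDiff ℝ ∞ ψ → HasCompactSupport ψ → tsupport ψ ⊆ G →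
      ∀ e : EuclideanSpace ℝ (Fin N),
        ∫ x in G, u x * fderiv ℝ ψ x e = -∫ x in G, inner ℝ (g x) e * ψ x

/-- `u ∈ H^1_loc(G)` with weak gradient `g`. -/
def MemH1Loc {N : ℕ} (G : Set (EuclideanSpace ℝ (Fin N)))
    (u : EuclideanSpace ℝ (Fin N) → ℝ)
    (g : EuclideanSpace ℝ (Fin N) → EuclideanSpace ℝ (Fin N)) : Prop :=
  HasWeakGradient G u g ∧
    ∀ K : Set (EuclideanSpace ℝ (Fin N)), IsCompact K → K ⊆ G →
      MemLp u 2 (volume.restrict K) ∧ MemLp g 2 (volume.restrict K)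

/-- `v ∈ H^1_c(G)` with weak gradient `w`: `v ∈ H^1(G)` vanishes almost everywhere outside some
compact subset of `G`. -/
def MemH1Compact {N : ℕ} (G : Set (EuclideanSpace ℝ (Fin N)))
    (v : EuclideanSpace ℝ (Fin N) → ℝ)
    (w : EuclideanSpace ℝ (Fin N) → EuclideanSpace ℝ (Fin N)) : Prop :=
  HasWeakGradient G v w ∧ MemLp v 2 (volume.restrict G) ∧ MemLp w 2 (volume.restrict G) ∧
    ∃ K : Set (EuclideanSpace ℝ (Fin N)), IsCompact K ∧ K ⊆ G ∧
      ∀ᵐ x ∂(volume.restrict G), x ∉ K → v x = 0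

/-- The weak form `∫_G ∇u · ∇v dx - ∫_G (μ / δ^2) u v dx` of `-Δ - μ / δ^2`, where `g = ∇u` and
`w = ∇v`. -/
noncomputable def hardyForm {N : ℕ} (Ω : Set (EuclideanSpace ℝ (Fin N))) (μ : ℝ)
    (G : Set (EuclideanSpace ℝ (Fin N)))
    (u : EuclideanSpace ℝ (Fin N) → ℝ)
    (g : EuclideanSpace ℝ (Fin N) → EuclideanSpace ℝ (Fin N))
    (v : EuclideanSpace ℝ (Fin N) → ℝ)
    (w : EuclideanSpace ℝ (Fin N) → EuclideanSpace ℝ (Fin N)) : ℝ :=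
  (∫ x in G, inner ℝ (g x) (w x)) - ∫ x in G, μ / bdryDist Ω x ^ 2 * u x * v x

/-- `u ∈ H^1_loc(G) ∩ C(G)` is a sub-harmonic of `-Δ - μ / δ^2` in `G ⊆ Ω`. -/
def IsSubharmonic {N : ℕ} (Ω : Set (EuclideanSpace ℝ (Fin N))) (μ : ℝ)
    (G : Set (EuclideanSpace ℝ (Fin N))) (u : EuclideanSpace ℝ (Fin N) → ℝ) : Prop :=
  ContinuousOn u G ∧ ∃ g, MemH1Loc G u g ∧
    ∀ v w, MemH1Compact G v w → (∀ᵐ x ∂(volume.restrict G), 0 ≤ v x) →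
      hardyForm Ω μ G u g v w ≤ 0

/-- `u ∈ H^1_loc(G) ∩ C(G)` is a super-harmonic of `-Δ - μ / δ^2` in `G ⊆ Ω`. -/
def IsSuperharmonic {N : ℕ} (Ω : Set (EuclideanSpace ℝ (Fin N))) (μ : ℝ)
    (G : Set (EuclideanSpace ℝ (Fin N))) (u : EuclideanSpace ℝ (Fin N) → ℝ) : Prop :=
  ContinuousOn u G ∧ ∃ g, MemH1Loc G u g ∧
    ∀ v w, MemH1Compact G v w → (∀ᵐ x ∂(volume.restrict G), 0 ≤ v x) →
      0 ≤ hardyForm Ω μ G u g v w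

/-- A local sub-harmonic: a sub-harmonic in some parallel set (values elsewhere are irrelevant). -/
def IsLocalSubharmonic {N : ℕ} (Ω : Set (EuclideanSpace ℝ (Fin N))) (μ : ℝ)
    (u : EuclideanSpace ℝ (Fin N) → ℝ) : Prop :=
  ∃ ρ : ℝ, 0 < ρ ∧ IsSubharmonic Ω μ (parallelSet Ω ρ) u

/-- `u` is positive in some parallel set. -/
def IsLocallyPositive {N : ℕ} (Ω : Set (EuclideanSpace ℝ (Fin N)))
    (u : EuclideanSpace ℝ (Fin N) → ℝ) : Prop :=
  ∃ ρ : ℝ, 0 < ρ ∧ ∀ x ∈ parallelSet Ω ρ, 0 < u x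

/-- A local super-harmonic that is positive in the parallel set where it is defined. -/
def IsPositiveLocalSuperharmonic {N : ℕ} (Ω : Set (EuclideanSpace ℝ (Fin N))) (μ : ℝ)
    (u : EuclideanSpace ℝ (Fin N) → ℝ) : Prop :=
  ∃ ρ : ℝ, 0 < ρ ∧ IsSuperharmonic Ω μ (parallelSet Ω ρ) u ∧ ∀ x ∈ parallelSet Ω ρ, 0 < u x

/-- A large sub-harmonic: a local sub-harmonic `u` such that `limsup_{x → ∂Ω} u / h > 0` (in the
extended reals) for every positive local super-harmonic `h`. -/
def IsLargeSubharmonic {N : ℕ} (Ω : Set (EuclideanSpace ℝ (Fin N))) (μ : ℝ)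
    (u : EuclideanSpace ℝ (Fin N) → ℝ) : Prop :=
  IsLocalSubharmonic Ω μ u ∧ ∀ h, IsPositiveLocalSuperharmonic Ω μ h →
    (0 : EReal) < limsup (fun x => ((u x / h x : ℝ) : EReal)) (toBoundary Ω)

/-- A small sub-harmonic: a local sub-harmonic that is not large. -/
def IsSmallSubharmonic {N : ℕ} (Ω : Set (EuclideanSpace ℝ (Fin N))) (μ : ℝ)
    (u : EuclideanSpace ℝ (Fin N) → ℝ) : Prop :=
  IsLocalSubharmonic Ω μ u ∧ ¬ IsLargeSubharmonic Ω μ u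

/-- `u` vanishes on the entire boundary: `u(x) → 0` as `x → x₀` in `Ω`, for every `x₀ ∈ ∂Ω`. -/
def VanishesOnBoundary {N : ℕ} (Ω : Set (EuclideanSpace ℝ (Fin N)))
    (u : EuclideanSpace ℝ (Fin N) → ℝ) : Prop :=
  ∀ x₀ ∈ frontier Ω, Tendsto u (𝓝[Ω] x₀) (𝓝 0)

section

open scoped Convolution

variable {N : ℕ}

/-! Everything rests on one barrier, `H = √(δ log (1/δ))`. Near the boundary `δ` is of class `C^2`
with `|∇δ| = 1` and bounded Laplacian, so `Δ f(δ) = f''(δ) + f'(δ) Δδ`. For `f(t) = √(t log (1/t))`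
one has `f'' = -f / (4 t²) - 1 / (4 f³)`. The first term matches the Hardy potential with the
critical constant `1/4`, and the second dominates the curvature term `f' Δδ`. Hence `H` is a strict
positive super-harmonic for every `μ ≤ 1/4`, and it tends to `0` at the boundary.

A strict positive super-harmonic of class `C^2` gives a comparison principle
(`IsSubharmonic.nonpos`). Testing the inequality for `u` with `u₊²/H` and the operator on `H` with
`u₊³/H²` cancels the potentials, and the gradient terms combine into a multiple of a square. What
remains forces `u₊ = 0`.

A Phragmén–Lindelöf bound follows (`le_mul_sqrt_negMulLog`). If `u ≤ ε h` near the boundary for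
every `ε > 0`, with `h` a positive local super-harmonic, then `u - C H - ε h` is non-positive
outside a compact subset of a parallel set, hence throughout it; letting `ε → 0` gives `u ≤ C H`. A
small sub-harmonic admits such an `h`, which proves (i).

For (ii), a sub-harmonic whose upper limit is finite at each boundary point is bounded above near
the compact boundary. It is then negligible against the super-harmonic `log (1/δ)`, available for `μ
< 0`, and cannot be large. For (iii), `δ^μ` is sub-harmonic; were it not large, it would be bounded
by `C H`, which fails because `μ < 1/2`.

The rest is infrastructure: a calculus of weak gradients obtained by mollification, and the
regularity of `δ` obtained from the inverse function theorem. -/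

abbrev Euc (N : ℕ) := EuclideanSpace ℝ (Fin N)

/-! ### Mollification -/

/-- A sequence of bump functions concentrating at the origin. -/
noncomputable def bumpSeq (N n : ℕ) : ContDiffBump (0 : Euc N) where
  rIn := 1 / ((n : ℝ) + 2)
  rOut := 1 / ((n : ℝ) + 1)
  rIn_pos := by positivity
  rIn_lt_rOut := by
    apply one_div_lt_one_div_of_lt <;> [positivity; linarith]

/-- The mollifying kernel. -/
noncomputable def mollifier (N n : ℕ) : Euc N → ℝ := (bumpSeq N n).normed volume

/-- The mollification of `k` at scale `1 / (n + 1)`. -/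
noncomputable def mollify {N : ℕ} (n : ℕ) (k : Euc N → ℝ) : Euc N → ℝ :=
  mollifier N n ⋆[ContinuousLinearMap.lsmul ℝ ℝ, volume] k

lemma tendsto_bumpSeq_rOut (N : ℕ) : Tendsto (fun n => (bumpSeq N n).rOut) atTop (𝓝 0) :=
  tendsto_one_div_add_atTop_nhds_zero_nat

lemma mollifier_contDiff (n : ℕ) : ContDiff ℝ ∞ (mollifier N n) :=
  (bumpSeq N n).contDiff_normed

lemma mollifier_hasCompactSupport (n : ℕ) : HasCompactSupport (mollifier N n) :=
  (bumpSeq N n).hasCompactSupport_normed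

lemma mollifier_neg (n : ℕ) (x : Euc N) : mollifier N n (-x) = mollifier N n x :=
  (bumpSeq N n).normed_neg x

lemma fderiv_mollifier_neg (n : ℕ) (x e : Euc N) :
    fderiv ℝ (mollifier N n) (-x) e = -fderiv ℝ (mollifier N n) x e := by
  have h : (fun y : Euc N => mollifier N n (-y)) = mollifier N n := funext (mollifier_neg n)
  have hd : DifferentiableAt ℝ (mollifier N n) (-x) :=
    (mollifier_contDiff n).contDiffAt.differentiableAt (by simp)
  have h2 := (hd.hasFDerivAt.comp x (hasFDerivAt_id x).neg).fderiv
  rw [show (mollifier N n ∘ Neg.neg) = mollifier N n from h] at h2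
  rw [h2]; simp

lemma mollify_contDiff (n : ℕ) {k : Euc N → ℝ} (hk : LocallyIntegrable k) :
    ContDiff ℝ ∞ (mollify n k) :=
  (mollifier_hasCompactSupport n).contDiff_convolution_left _ (mollifier_contDiff n) hk

lemma mollify_apply (n : ℕ) (k : Euc N → ℝ) (x : Euc N) :
    mollify n k x = ∫ t, mollifier N n t * k (x - t) := by
  simp [mollify, convolution]

lemma abs_mollify_le (n : ℕ) {k : Euc N → ℝ} {C : ℝ} (hC : ∀ x, |k x| ≤ C) (x : Euc N) :
    |mollify n k x| ≤ C := by
  rw [mollify_apply, ← Real.norm_eq_abs]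
  have h1 : ∫ t, mollifier N n t = 1 := (bumpSeq N n).integral_normed
  calc ‖∫ t, mollifier N n t * k (x - t)‖ ≤ ∫ t, mollifier N n t * C := by
        apply norm_integral_le_of_norm_le
        · exact ((bumpSeq N n).integrable_normed).mul_const C
        · refine Eventually.of_forall fun t => ?_
          have h0 : 0 ≤ mollifier N n t := (bumpSeq N n).nonneg_normed t
          rw [norm_mul, Real.norm_of_nonneg h0]
          exact mul_le_mul_of_nonneg_left (hC _) h0
    _ = C := by rw [integral_mul_const, h1, one_mul]

lemma fderiv_mollify (n : ℕ) {k : Euc N → ℝ} (hk : ContDiff ℝ 1 k) (hc : HasCompactSupport k)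
    (x e : Euc N) :
    fderiv ℝ (mollify n k) x e = mollify n (fun y => fderiv ℝ k y e) x := by
  have h := hc.hasFDerivAt_convolution_right (ContinuousLinearMap.lsmul ℝ ℝ)
    (f := mollifier N n) (μ := volume)
    ((mollifier_contDiff n).continuous.locallyIntegrable) hk x
  rw [show fderiv ℝ (mollify n k) x = _ from h.fderiv]
  have hcd : Continuous (fderiv ℝ k) := hk.continuous_fderiv one_ne_zero
  rw [convolution_precompR_apply _ (mollifier_contDiff n).continuous.locallyIntegrable
    (hc.fderiv ℝ) hcd]
  rfl

/-- The derivative falls on the kernel, so `k` need only be locally integrable. -/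
lemma fderiv_mollify' (n : ℕ) {k : Euc N → ℝ} (hk : LocallyIntegrable k) (x e : Euc N) :
    fderiv ℝ (mollify n k) x e = ∫ t, fderiv ℝ (mollifier N n) (x - t) e * k t := by
  have h := (mollifier_hasCompactSupport n).hasFDerivAt_convolution_left
    (ContinuousLinearMap.lsmul ℝ ℝ) (g := k) (μ := volume) ((mollifier_contDiff n).of_le
      (by exact_mod_cast le_top)) hk x
  rw [show fderiv ℝ (mollify n k) x = _ from h.fderiv]
  have hcd : Continuous (fderiv ℝ (mollifier N n)) :=
    (mollifier_contDiff n).continuous_fderiv (by simp)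
  rw [convolution_eq_swap, ContinuousLinearMap.integral_apply]
  · rfl
  · exact ((mollifier_hasCompactSupport n).fderiv ℝ).convolutionExists_left _ hcd hk x |>.integrable_swap

lemma tsupport_mollify_subset (n : ℕ) {k : Euc N → ℝ} {r : ℝ} (hr : 1 / ((n : ℝ) + 1) ≤ r) :
    tsupport (mollify n k) ⊆ Metric.cthickening r (tsupport k) := by
  apply closure_minimal _ Metric.isClosed_cthickening
  refine (support_convolution_subset _).trans ?_
  rintro _ ⟨a, ha, b, hb, rfl⟩
  have ha' : a ∈ Metric.ball (0 : Euc N) (1 / ((n : ℝ) + 1)) := by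
    have := (bumpSeq N n).support_normed_eq (μ := volume)
    rw [show (mollifier N n) = (bumpSeq N n).normed volume from rfl, this] at ha
    exact ha
  refine Metric.mem_cthickening_of_dist_le _ b _ _ (subset_tsupport _ hb) ?_
  simp only [dist_add_self_left]
  rw [mem_ball_zero_iff] at ha'
  linarith

/-- The mollified function may vary with `n`: the chain rule below mollifies `ψ · η'(wₙ)`, where
`wₙ` is itself a mollification. -/
lemma mollify_tendsto {k : ℕ → Euc N → ℝ} {x : Euc N} {z : ℝ}
    (hm : ∀ n, AEStronglyMeasurable (k n))
    (hk : Tendsto (Function.uncurry k) (atTop ×ˢ 𝓝 x) (𝓝 z)) :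
    Tendsto (fun n => mollify n (k n) x) atTop (𝓝 z) :=
  ContDiffBump.convolution_tendsto_right (tendsto_bumpSeq_rOut N) (Eventually.of_forall hm) hk
    tendsto_const_nhds

/-- Convergence jointly in the scale and the point is what `mollify_tendsto` requires of a varying
sequence. -/
lemma mollify_tendsto_prod {k : Euc N → ℝ} {x : Euc N}
    (hm : AEStronglyMeasurable k) (hk : ContinuousAt k x) :
    Tendsto (fun p : ℕ × Euc N => mollify p.1 k p.2) (atTop ×ˢ 𝓝 x) (𝓝 (k x)) := by
  refine ContDiffBump.convolution_tendsto_right (φ := fun p : ℕ × Euc N => bumpSeq N p.1)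
    (g := fun _ => k) (k := Prod.snd)
    ((tendsto_bumpSeq_rOut N).comp tendsto_fst) (Eventually.of_forall fun _ => hm) ?_ tendsto_snd
  exact hk.tendsto.comp tendsto_snd

/-- The kernel is even, so its derivative is odd, and Fubini moves the mollified derivative from one
factor to the other with a change of sign. No differentiability of `w` or `θ` is involved. -/
lemma integral_mul_fderiv_mollify (n : ℕ) {w θ : Euc N → ℝ} (hw : Integrable w)
    (hθ : Integrable θ) (e : Euc N) :
    ∫ x, w x * fderiv ℝ (mollify n θ) x e = -∫ x, fderiv ℝ (mollify n w) x e * θ x := by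
  simp_rw [fderiv_mollify' n hθ.locallyIntegrable, fderiv_mollify' n hw.locallyIntegrable,
    ← integral_const_mul, ← integral_mul_const]
  rw [← integral_neg, integral_integral_swap]
  · congr 1; ext x
    rw [← integral_neg]
    congr 1; ext y
    rw [show y - x = -(x - y) by abel, fderiv_mollifier_neg]; ring
  · have hcd : Continuous (fderiv ℝ (mollifier N n)) :=
      (mollifier_contDiff n).continuous_fderiv (by simp)
    obtain ⟨C, hC⟩ := ((mollifier_hasCompactSupport n).fderiv ℝ).exists_bound_of_continuous hcd
    have h1 : Integrable (fun p : Euc N × Euc N => w p.1 * θ p.2) (volume.prod volume) :=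
      hw.mul_prod hθ
    have h2 := h1.bdd_mul (c := C * ‖e‖)
      (f := fun p : Euc N × Euc N => fderiv ℝ (mollifier N n) (p.1 - p.2) e)
      (by
        apply Continuous.aestronglyMeasurable
        exact (hcd.comp (continuous_fst.sub continuous_snd)).clm_apply continuous_const)
      (Eventually.of_forall fun p => (ContinuousLinearMap.le_opNorm _ _).trans
        (by gcongr; exact hC _))
    refine h2.congr (Eventually.of_forall fun p => ?_)
    simp [Function.uncurry]; ring

lemma hasCompactSupport_mollify (n : ℕ) {k : Euc N → ℝ} (hk : HasCompactSupport k) :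
    HasCompactSupport (mollify n k) :=
  HasCompactSupport.convolution _ (mollifier_hasCompactSupport n) hk

attribute [irreducible] mollify

/-! ### Calculus of weak gradients -/

/-- Dominated convergence with majorant `C |f|` on `K`. The common compact set for the supports is
what makes local integrability of `f` sufficient. -/
lemma tendsto_setIntegral_mul {G : Set (Euc N)} {f : Euc N → ℝ} (hf : LocallyIntegrableOn f G)
    {K : Set (Euc N)} (hK : IsCompact K) (hKG : K ⊆ G) {θ : ℕ → Euc N → ℝ} {θ' : Euc N → ℝ} (C : ℝ)
    (hcont : ∀ n, Continuous (θ n)) (hb : ∀ n x, |θ n x| ≤ C)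
    (hs : ∀ᶠ n in atTop, ∀ x, x ∉ K → θ n x = 0)
    (hlim : ∀ x, Tendsto (fun n => θ n x) atTop (𝓝 (θ' x))) :
    Tendsto (fun n => ∫ x in G, f x * θ n x) atTop (𝓝 (∫ x in G, f x * θ' x)) := by
  have hfK : IntegrableOn f K := hf.integrableOn_compact_subset hKG hK
  refine tendsto_integral_filter_of_dominated_convergence (K.indicator fun x => |f x| * C)
    (Eventually.of_forall fun n => hf.aestronglyMeasurable.mul (hcont n).aestronglyMeasurable)
    ?_ ?_ (Eventually.of_forall fun x => (hlim x).const_mul _)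
  · filter_upwards [hs] with n hn
    refine Eventually.of_forall fun x => ?_
    by_cases hx : x ∈ K
    · rw [indicator_of_mem hx, norm_mul]
      exact mul_le_mul_of_nonneg_left (hb n x) (norm_nonneg _)
    · simp [indicator_of_notMem hx, hn x hx]
  · have : IntegrableOn (fun x => |f x| * C) K := hfK.abs.mul_const C
    exact (this.integrable_indicator hK.measurableSet).restrict

lemma eventually_one_div_le {r : ℝ} (hr : 0 < r) : ∀ᶠ n : ℕ in atTop, 1 / ((n : ℝ) + 1) ≤ r :=
  (tendsto_one_div_add_atTop_nhds_zero_nat (𝕜 := ℝ)).eventually_le_const hr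

lemma mollify_eq_zero {n : ℕ} {k : Euc N → ℝ} {r : ℝ} (hr : 1 / ((n : ℝ) + 1) ≤ r) {x : Euc N}
    (hx : x ∉ Metric.cthickening r (tsupport k)) : mollify n k x = 0 :=
  image_eq_zero_of_notMem_tsupport fun h => hx (tsupport_mollify_subset n hr h)

lemma fderiv_apply_eq_zero {k : Euc N → ℝ} {x : Euc N} (hx : x ∉ tsupport k) (e : Euc N) :
    fderiv ℝ k x e = 0 := by
  rw [image_eq_zero_of_notMem_tsupport fun h => hx (tsupport_fderiv_subset ℝ h)]; simp

lemma LocallyIntegrableOn.inner_right {G : Set (Euc N)} {g : Euc N → Euc N}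
    (hg : LocallyIntegrableOn g G) (e : Euc N) :
    LocallyIntegrableOn (fun x => inner ℝ (g x) e) G := by
  intro x hx
  obtain ⟨t, ht, hgt⟩ := hg x hx
  exact ⟨t, ht, Integrable.inner_const hgt e⟩

lemma tendsto_prod_mk_right {F : ℕ × Euc N → ℝ} {x : Euc N} {z : ℝ}
    (h : Tendsto F (atTop ×ˢ 𝓝 x) (𝓝 z)) : Tendsto (fun n => F (n, x)) atTop (𝓝 z) := by
  have hf : Tendsto (fun n : ℕ => (n, x)) atTop (atTop ×ˢ 𝓝 x) :=
    Filter.Tendsto.prodMk tendsto_id tendsto_const_nhds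
  exact h.comp hf

/-- The defining identity of the weak gradient extends to test functions of class `C^1`. -/
lemma HasWeakGradient.integral_mul_fderiv {G : Set (Euc N)} {u : Euc N → ℝ} {g : Euc N → Euc N}
    (h : HasWeakGradient G u g) (hG : IsOpen G) {ψ : Euc N → ℝ} (hψ : ContDiff ℝ 1 ψ)
    (hc : HasCompactSupport ψ) (hs : tsupport ψ ⊆ G) (e : Euc N) :
    ∫ x in G, u x * fderiv ℝ ψ x e = -∫ x in G, inner ℝ (g x) e * ψ x := by
  obtain ⟨hu, hg, hw⟩ := h
  obtain ⟨r, hr, hrG⟩ := hc.exists_cthickening_subset_open hG hs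
  have hK : IsCompact (Metric.cthickening r (tsupport ψ)) := hc.cthickening
  have hdc : Continuous fun x => fderiv ℝ ψ x e :=
    (hψ.continuous_fderiv one_ne_zero).clm_apply continuous_const
  have hdcs : HasCompactSupport fun x => fderiv ℝ ψ x e := hc.fderiv_apply ℝ e
  obtain ⟨C₀, hC₀⟩ := hc.exists_bound_of_continuous hψ.continuous
  obtain ⟨C₁, hC₁⟩ := hdcs.exists_bound_of_continuous hdc
  have hsm : ∀ n, ContDiff ℝ ∞ (mollify n ψ) := fun n =>
    mollify_contDiff n hψ.continuous.locallyIntegrable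
  have hge : LocallyIntegrableOn (fun x => inner ℝ (g x) e) G := LocallyIntegrableOn.inner_right hg e
  have h1 : Tendsto (fun n => ∫ x in G, u x * fderiv ℝ (mollify n ψ) x e) atTop
      (𝓝 (∫ x in G, u x * fderiv ℝ ψ x e)) := by
    refine tendsto_setIntegral_mul hu hK hrG C₁ (fun n => ?_) (fun n x => ?_) ?_ fun x => ?_
    · exact ((hsm n).continuous_fderiv (by simp)).clm_apply continuous_const
    · rw [fderiv_mollify n hψ hc]
      exact abs_mollify_le n hC₁ x
    · filter_upwards [eventually_one_div_le hr] with n hn x hx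
      exact fderiv_apply_eq_zero (fun h => hx (tsupport_mollify_subset n hn h)) e
    · simp_rw [fderiv_mollify _ hψ hc]
      exact mollify_tendsto (fun _ => hdc.aestronglyMeasurable)
        (hdc.continuousAt.tendsto.comp tendsto_snd)
  have h2 : Tendsto (fun n => ∫ x in G, inner ℝ (g x) e * mollify n ψ x) atTop
      (𝓝 (∫ x in G, inner ℝ (g x) e * ψ x)) := by
    refine tendsto_setIntegral_mul hge hK hrG C₀ (fun n => (hsm n).continuous)
      (fun n x => abs_mollify_le n hC₀ x) ?_ fun x => ?_
    · filter_upwards [eventually_one_div_le hr] with n hn x hx using mollify_eq_zero hn hx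
    · exact mollify_tendsto (fun _ => hψ.continuous.aestronglyMeasurable)
        (hψ.continuous.continuousAt.tendsto.comp tendsto_snd)
  refine tendsto_nhds_unique (h1.congr' ?_) h2.neg
  filter_upwards [eventually_one_div_le hr] with n hn
  exact hw _ (hsm n) (hasCompactSupport_mollify n hc)
    ((tsupport_mollify_subset n hn).trans hrG) e

set_option maxHeartbeats 1000000 in
/-- Chain rule for the weak gradient of a continuous function. -/
lemma HasWeakGradient.comp {G : Set (Euc N)} {u : Euc N → ℝ} {g : Euc N → Euc N}
    (h : HasWeakGradient G u g) (hG : IsOpen G) (hcu : ContinuousOn u G) {η : ℝ → ℝ}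
    (hη : ContDiff ℝ 1 η) :
    HasWeakGradient G (fun x => η (u x)) (fun x => deriv η (u x) • g x) := by
  obtain ⟨hu, hg, hw⟩ := h
  have hη' : Continuous (deriv η) := hη.continuous_deriv le_rfl
  refine ⟨(hη.continuous.comp_continuousOn hcu).locallyIntegrableOn hG.measurableSet,
    hg.continuousOn_smul hG.isLocallyClosed (hη'.comp_continuousOn hcu), fun ψ hψ hc hs e => ?_⟩
  obtain ⟨r, hr, hrG⟩ := hc.exists_cthickening_subset_open hG hs
  set K := Metric.cthickening r (tsupport ψ) with hKdef
  have hK : IsCompact K := hc.cthickening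
  have hψc := hψ.continuous
  have hdψ : Continuous fun x => fderiv ℝ ψ x e :=
    (hψ.continuous_fderiv (by simp)).clm_apply continuous_const
  have hdψs : HasCompactSupport fun x => fderiv ℝ ψ x e := hc.fderiv_apply (𝕜 := ℝ) e
  -- Truncation makes `u` bounded and integrable, hence fit for mollification, and changes nothing
  -- near the support of `ψ`.
  set w : Euc N → ℝ := K.indicator u with hwdef
  have hwint : Integrable w :=
    (hu.integrableOn_compact_subset hrG hK).integrable_indicator hK.measurableSet
  obtain ⟨M, hM⟩ := hK.exists_bound_of_continuousOn (hcu.mono hrG)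
  have hM' : ∀ x, |w x| ≤ max M 0 := fun x => by
    by_cases hx : x ∈ K
    · simp only [hwdef, indicator_of_mem hx]; exact (hM x hx).trans (le_max_left _ _)
    · simp [hwdef, indicator_of_notMem hx]
  have hwn : ∀ n, ContDiff ℝ ∞ (mollify n w) := fun n => mollify_contDiff n hwint.locallyIntegrable
  have hwM : ∀ n x, mollify n w x ∈ Icc (-max M 0) (max M 0) := fun n x =>
    abs_le.1 (abs_mollify_le n hM' x)
  obtain ⟨A, hA⟩ := isCompact_Icc.exists_bound_of_continuousOn
    (hη.continuous.continuousOn (s := Icc (-max M 0) (max M 0)))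
  obtain ⟨B, hB⟩ := isCompact_Icc.exists_bound_of_continuousOn
    (hη'.continuousOn (s := Icc (-max M 0) (max M 0)))
  obtain ⟨C₀, hC₀⟩ := hc.exists_bound_of_continuous hψc
  obtain ⟨C₁, hC₁⟩ := hdψs.exists_bound_of_continuous hdψ
  have hC₀' : 0 ≤ C₀ := (norm_nonneg _).trans (hC₀ 0)
  have hC₁' : 0 ≤ C₁ := (norm_nonneg _).trans (hC₁ 0)
  have hwlim : ∀ x ∈ tsupport ψ,
      Tendsto (fun p : ℕ × Euc N => mollify p.1 w p.2) (atTop ×ˢ 𝓝 x) (𝓝 (u x)) := by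
    intro x hx
    have hnear : w =ᶠ[𝓝 x] u := by
      filter_upwards [Metric.ball_mem_nhds x hr] with y hy
      exact indicator_of_mem (Metric.mem_cthickening_of_dist_le y x r _ hx
        (Metric.mem_ball.1 hy).le) u
    have := mollify_tendsto_prod (x := x) hwint.aestronglyMeasurable
      ((hcu.continuousAt (hG.mem_nhds (hs hx))).congr hnear.symm)
    rwa [hnear.eq_of_nhds] at this
  -- With `wₙ` the mollification of `w`, the classical chain rule gives `∫ η(wₙ) ∂ψ = -∫ ∂wₙ θₙ`.
  -- Moving the mollification onto `θₙ` turns the right side into `∫ u ∂Ψₙ`, with `Ψₙ` the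
  -- mollification of `θₙ`. As `Ψₙ` is a smooth test function, this is `-∫ (g · e) Ψₙ`, and both
  -- ends converge.
  set θ : ℕ → Euc N → ℝ := fun n x => ψ x * deriv η (mollify n w x) with hθdef
  have hθc : ∀ n, Continuous (θ n) := fun n => hψc.mul (hη'.comp (hwn n).continuous)
  have hθs : ∀ n, HasCompactSupport (θ n) := fun n => hc.mul_right
  have hθt : ∀ n, tsupport (θ n) ⊆ tsupport ψ := fun n => closure_mono (Function.support_mul_subset_left _ _)
  have hθb : ∀ n x, |θ n x| ≤ C₀ * B := fun n x => by
    rw [hθdef, abs_mul]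
    exact mul_le_mul (hC₀ x) (hB _ (hwM n x)) (abs_nonneg _) hC₀'
  have hΨ : ∀ n, ContDiff ℝ ∞ (mollify n (θ n)) := fun n =>
    mollify_contDiff n (hθc n).locallyIntegrable
  have h1 : Tendsto (fun n => ∫ x in G, η (mollify n w x) * fderiv ℝ ψ x e) atTop
      (𝓝 (∫ x in G, η (u x) * fderiv ℝ ψ x e)) := by
    have := tendsto_setIntegral_mul (G := G) (f := fun _ => (1 : ℝ))
      (θ := fun n x => η (mollify n w x) * fderiv ℝ ψ x e)
      (θ' := fun x => η (u x) * fderiv ℝ ψ x e)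
      ((locallyIntegrable_const 1).locallyIntegrableOn G) hc hs (A * C₁)
      (fun n => (hη.continuous.comp (hwn n).continuous).mul hdψ) (fun n x => ?_)
      (Eventually.of_forall fun n x hx => ?_) fun x => ?_
    · simpa using this
    · rw [abs_mul]
      exact mul_le_mul (hA _ (hwM n x)) (hC₁ x) (abs_nonneg _)
        ((norm_nonneg _).trans (hA _ (hwM n x)))
    · simp [fderiv_apply_eq_zero hx]
    · by_cases hx : x ∈ tsupport ψ
      · have hx2 := tendsto_prod_mk_right (hwlim x hx)
        have hx3 := (hη.continuous.tendsto (u x)).comp hx2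
        exact hx3.mul_const _
      · simp [fderiv_apply_eq_zero hx]
  have h2 : Tendsto (fun n => ∫ x in G, inner ℝ (g x) e * mollify n (θ n) x) atTop
      (𝓝 (∫ x in G, inner ℝ (g x) e * (ψ x * deriv η (u x)))) := by
    refine tendsto_setIntegral_mul (LocallyIntegrableOn.inner_right hg e) hK hrG (C₀ * B)
      (fun n => (hΨ n).continuous) (fun n x => abs_mollify_le n (hθb n) x) ?_ fun x => ?_
    · filter_upwards [eventually_one_div_le hr] with n hn x hx
      exact mollify_eq_zero hn fun h => hx (Metric.cthickening_subset_of_subset r (hθt n) h)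
    · refine mollify_tendsto (fun n => (hθc n).aestronglyMeasurable) ?_
      by_cases hx : x ∈ tsupport ψ
      · exact ((hψc.tendsto x).comp tendsto_snd).mul ((hη'.tendsto _).comp (hwlim x hx))
      · have h0 : ψ =ᶠ[𝓝 x] 0 := notMem_tsupport_iff_eventuallyEq.1 hx
        rw [h0.eq_of_nhds]
        refine Tendsto.congr' (f₁ := fun _ => 0) ?_ (by simp)
        filter_upwards [tendsto_snd.eventually h0] with p hp
        simp [Function.uncurry, hθdef, hp]
  have h3 : ∀ᶠ n in atTop, ∫ x in G, η (mollify n w x) * fderiv ℝ ψ x e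
      = -∫ x in G, inner ℝ (g x) e * mollify n (θ n) x := by
    filter_upwards [eventually_one_div_le hr] with n hn
    have hsub : tsupport (mollify n (θ n)) ⊆ K :=
      (tsupport_mollify_subset n hn).trans (Metric.cthickening_subset_of_subset r (hθt n))
    rw [← hw _ (hΨ n) (hasCompactSupport_mollify n (hθs n)) (hsub.trans hrG) e]
    have e1 : ∫ x in G, u x * fderiv ℝ (mollify n (θ n)) x e
        = ∫ x, w x * fderiv ℝ (mollify n (θ n)) x e := by
      rw [← setIntegral_eq_integral_of_forall_compl_eq_zero (s := G)
        (f := fun x => w x * fderiv ℝ (mollify n (θ n)) x e)]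
      · refine integral_congr_ae (Eventually.of_forall fun x => ?_)
        by_cases hx : x ∈ K
        · simp [hwdef, indicator_of_mem hx]
        · simp [fderiv_apply_eq_zero (k := mollify n (θ n)) fun h => hx (hsub h)]
      · intro x hx
        rw [fderiv_apply_eq_zero fun h => hx (hrG (hsub h)), mul_zero]
    have e2 : ∫ x in G, η (mollify n w x) * fderiv ℝ ψ x e
        = ∫ x, η (mollify n w x) * fderiv ℝ ψ x e := by
      apply setIntegral_eq_integral_of_forall_compl_eq_zero
      intro x hx
      rw [fderiv_apply_eq_zero fun h => hx (hs h), mul_zero]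
    have hηd : ∀ x, fderiv ℝ (fun x => η (mollify n w x)) x e
        = deriv η (mollify n w x) * fderiv ℝ (mollify n w) x e := fun x => by
      have a := (hη.differentiable one_ne_zero (mollify n w x)).hasDerivAt
      have b := ((hwn n).differentiable (by simp) x).hasFDerivAt
      have c := (a.comp_hasFDerivAt x b).fderiv
      rw [show (fun x => η (mollify n w x)) = η ∘ mollify n w from rfl, c]; simp
    have hdw : Continuous fun x => fderiv ℝ (mollify n w) x e :=
      ((hwn n).continuous_fderiv (by simp)).clm_apply continuous_const
    rw [e1, e2, integral_mul_fderiv_mollify n hwint ((hθc n).integrable_of_hasCompactSupport (hθs n)),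
      integral_mul_fderiv_eq_neg_fderiv_mul_of_integrable]
    · congr 2; ext x
      rw [hηd, hθdef]; ring
    · simp_rw [hηd]
      exact (((hη'.comp (hwn n).continuous).mul hdw).mul hψc).integrable_of_hasCompactSupport
        hc.mul_left
    · exact ((hη.continuous.comp (hwn n).continuous).mul hdψ).integrable_of_hasCompactSupport
        hdψs.mul_left
    · exact ((hη.continuous.comp (hwn n).continuous).mul hψc).integrable_of_hasCompactSupport
        hc.mul_left
    · exact fun x _ => (hη.differentiable one_ne_zero _).comp x ((hwn n).differentiable (by simp) x)
    · exact fun x _ => hψ.differentiable (by simp) x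
  rw [tendsto_nhds_unique (h1.congr' h3) h2.neg]
  congr 2; ext x
  rw [real_inner_smul_left]; ring

lemma exists_smooth_cutoff {K G : Set (Euc N)} (hK : IsCompact K) (hG : IsOpen G) (hKG : K ⊆ G) :
    ∃ χ : Euc N → ℝ, ContDiff ℝ ∞ χ ∧ HasCompactSupport χ ∧ tsupport χ ⊆ G ∧
      ∀ x ∈ K, χ =ᶠ[𝓝 x] 1 := by
  obtain ⟨r, hr, hrG⟩ := hK.exists_cthickening_subset_open hG hKG
  have hsub : K ⊆ interior (Metric.cthickening r K) :=
    (Metric.self_subset_thickening hr K).trans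
      (Metric.isOpen_thickening.subset_interior_iff.2 (Metric.thickening_subset_cthickening r K))
  obtain ⟨f, hf1, hf0, -⟩ := exists_contMDiffMap_one_nhds_of_subset_interior (n := (⊤ : ℕ∞))
    (modelWithCornersSelf ℝ (Euc N)) hK.isClosed hsub
  have hts : tsupport f ⊆ Metric.cthickening r K :=
    closure_minimal (fun x hx => by_contra fun h => hx (hf0 x h)) Metric.isClosed_cthickening
  refine ⟨f, f.contMDiff.contDiff, hK.cthickening.of_isClosed_subset (isClosed_tsupport _) hts,
    hts.trans hrG, fun x hx => ?_⟩
  exact hf1.filter_mono (nhds_le_nhdsSet hx)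

lemma contDiffOn_of_hasGradientAt {G : Set (Euc N)} (hG : IsOpen G) {k : Euc N → ℝ}
    {X : Euc N → Euc N} (hk : ∀ x ∈ G, HasGradientAt k (X x) x) (hX : ContinuousOn X G) :
    ContDiffOn ℝ 1 k G := by
  rw [show (1 : WithTop ℕ∞) = 0 + 1 from rfl, contDiffOn_succ_iff_fderiv_of_isOpen hG]
  refine ⟨fun x hx => (hk x hx).hasFDerivAt.differentiableAt.differentiableWithinAt, by simp, ?_⟩
  rw [contDiffOn_zero]
  refine ((InnerProductSpace.toDual ℝ (Euc N)).continuous.comp_continuousOn hX).congr fun x hx => ?_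
  exact (hk x hx).hasFDerivAt.fderiv

/-- Makes `k ψ` a global `C^1` test function although `k` is controlled only in `G`; this is why the
weak gradient identity was extended beyond smooth test functions. -/
lemma contDiff_mul_of_tsupport {G : Set (Euc N)} (hG : IsOpen G) {k ψ : Euc N → ℝ}
    (hk : ContDiffOn ℝ 1 k G) (hψ : ContDiff ℝ 1 ψ) (hs : tsupport ψ ⊆ G) :
    ContDiff ℝ 1 (fun x => k x * ψ x) := by
  rw [contDiff_iff_contDiffAt]
  intro x
  by_cases hx : x ∈ tsupport ψ
  · exact (hk.contDiffAt (hG.mem_nhds (hs hx))).mul hψ.contDiffAt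
  · refine (contDiffAt_const (c := (0 : ℝ))).congr_of_eventuallyEq ?_
    filter_upwards [notMem_tsupport_iff_eventuallyEq.1 hx] with y hy
    simp [hy]

lemma tsupport_mul_subset_right' {k ψ : Euc N → ℝ} :
    tsupport (fun x => k x * ψ x) ⊆ tsupport ψ :=
  closure_mono (Function.support_mul_subset_right _ _)

lemma integrableOn_mul_of_ae_eq_zero {G K : Set (Euc N)} (hG : IsOpen G) (hK : IsCompact K)
    (hKG : K ⊆ G) {f θ : Euc N → ℝ} (hf : LocallyIntegrableOn f G) (hθ : ContinuousOn θ G)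
    (h0 : ∀ᵐ x ∂volume.restrict G, x ∉ K → f x * θ x = 0) :
    IntegrableOn (fun x => f x * θ x) G := by
  have h1 : IntegrableOn (fun x => f x * θ x) K :=
    (hf.integrableOn_compact_subset hKG hK).mul_continuousOn (hθ.mono hKG) hK
  refine h1.of_ae_sdiff_eq_zero hG.measurableSet.nullMeasurableSet ?_
  rw [ae_restrict_iff' hG.measurableSet] at h0
  filter_upwards [h0] with x hx hx2 using hx hx2.1 hx2.2

lemma integrableOn_mul_of_tsupport {G : Set (Euc N)} (hG : IsOpen G) {f θ : Euc N → ℝ}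
    (hf : LocallyIntegrableOn f G) (hθ : ContinuousOn θ G) (hc : HasCompactSupport θ)
    (hs : tsupport θ ⊆ G) : IntegrableOn (fun x => f x * θ x) G :=
  integrableOn_mul_of_ae_eq_zero hG hc hs hf hθ (Eventually.of_forall fun x hx => by
    rw [image_eq_zero_of_notMem_tsupport hx, mul_zero])

lemma fderiv_mul_gradient {k ψ : Euc N → ℝ} {x X : Euc N} (hk : HasGradientAt k X x)
    (hψ : DifferentiableAt ℝ ψ x) (e : Euc N) :
    fderiv ℝ (fun x => k x * ψ x) x e = k x * fderiv ℝ ψ x e + ψ x * inner ℝ X e := by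
  have := (hk.hasFDerivAt.mul hψ.hasFDerivAt).fderiv
  rw [show (fun x => k x * ψ x) = k * ψ from rfl, this]
  simp

/-- Product rule for a weak gradient and a function of class `C^1`. -/
lemma HasWeakGradient.mul {G : Set (Euc N)} {u : Euc N → ℝ} {g : Euc N → Euc N}
    (h : HasWeakGradient G u g) (hG : IsOpen G) {k : Euc N → ℝ} {X : Euc N → Euc N}
    (hk : ∀ x ∈ G, HasGradientAt k (X x) x) (hX : ContinuousOn X G) :
    HasWeakGradient G (fun x => k x * u x) (fun x => k x • g x + u x • X x) := by
  have hkd := contDiffOn_of_hasGradientAt hG hk hX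
  have hkc := hkd.continuousOn
  have hlc := hG.isLocallyClosed
  refine ⟨h.1.continuousOn_smul hlc hkc, (h.2.1.continuousOn_smul hlc hkc).add
    (h.1.smul_continuousOn hlc hX), fun ψ hψ hc hs e => ?_⟩
  have hψ1 : ContDiff ℝ 1 ψ := hψ.of_le (by exact_mod_cast le_top)
  have hm := contDiff_mul_of_tsupport hG hkd hψ1 hs
  have hts : tsupport (fun x => k x * ψ x) ⊆ tsupport ψ := tsupport_mul_subset_right'
  have hkψc : HasCompactSupport fun x => k x * ψ x := hc.mul_left
  have key := h.integral_mul_fderiv hG hm hkψc (hts.trans hs) e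
  have hXe : ContinuousOn (fun x => inner ℝ (X x) e) G := hX.inner continuousOn_const
  have i1 : IntegrableOn (fun x => u x * fderiv ℝ (fun x => k x * ψ x) x e) G := by
    refine integrableOn_mul_of_tsupport hG h.1 ?_ (hkψc.fderiv_apply (𝕜 := ℝ) e)
      ((tsupport_fderiv_apply_subset ℝ e).trans (hts.trans hs))
    exact ((hm.continuous_fderiv one_ne_zero).clm_apply continuous_const).continuousOn
  have i2 : IntegrableOn (fun x => u x * (inner ℝ (X x) e * ψ x)) G := by
    exact integrableOn_mul_of_tsupport hG h.1 (hXe.mul hψ.continuous.continuousOn) hc.mul_left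
      (tsupport_mul_subset_right'.trans hs)
  have i3 : IntegrableOn (fun x => inner ℝ (g x) e * (k x * ψ x)) G :=
    integrableOn_mul_of_tsupport hG (LocallyIntegrableOn.inner_right h.2.1 e)
      hm.continuous.continuousOn hkψc (hts.trans hs)
  have i3' : IntegrableOn (fun x => -(inner ℝ (g x) e * (k x * ψ x))) G := i3.neg
  calc ∫ x in G, k x * u x * fderiv ℝ ψ x e
      = ∫ x in G, (u x * fderiv ℝ (fun x => k x * ψ x) x e - u x * (inner ℝ (X x) e * ψ x)) := by
        refine setIntegral_congr_fun hG.measurableSet fun x hx => ?_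
        rw [fderiv_mul_gradient (hk x hx) (hψ1.differentiable one_ne_zero x)]
        ring
    _ = -∫ x in G, inner ℝ (k x • g x + u x • X x) e * ψ x := by
        rw [integral_sub i1 i2, key, ← integral_neg, ← integral_neg, ← integral_sub i3' i2]
        congr 1; ext x
        rw [inner_add_left, real_inner_smul_left, real_inner_smul_left]
        ring

lemma HasWeakGradient.mono {G G' : Set (Euc N)} {u : Euc N → ℝ} {g : Euc N → Euc N}
    (h : HasWeakGradient G u g) (hG : G' ⊆ G) (hGo : IsOpen G) :
    HasWeakGradient G' u g := by
  refine ⟨h.1.mono_set hG, h.2.1.mono_set hG, fun ψ hψ hc hs e => ?_⟩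
  have := h.2.2 ψ hψ hc (hs.trans hG) e
  rwa [setIntegral_eq_of_subset_of_forall_sdiff_eq_zero hGo.measurableSet hG,
    setIntegral_eq_of_subset_of_forall_sdiff_eq_zero hGo.measurableSet hG] at this
  · intro x hx
    rw [image_eq_zero_of_notMem_tsupport fun h => hx.2 (hs h), mul_zero]
  · intro x hx
    rw [fderiv_apply_eq_zero fun h => hx.2 (hs h), mul_zero]

/-- The weak gradient vanishes where the function does. -/
lemma HasWeakGradient.ae_eq_zero {G K : Set (Euc N)} {v : Euc N → ℝ} {w : Euc N → Euc N}
    (h : HasWeakGradient G v w) (hG : IsOpen G) (hK : IsClosed K)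
    (h0 : ∀ᵐ x ∂volume.restrict G, x ∉ K → v x = 0) :
    ∀ᵐ x ∂volume.restrict G, x ∉ K → w x = 0 := by
  have hU : IsOpen (G \ K) := hG.sdiff hK
  have hm : HasWeakGradient (G \ K) v w := h.mono sdiff_subset hG
  have h0' : ∀ᵐ x ∂volume.restrict (G \ K), v x = 0 := by
    rw [ae_restrict_iff' hG.measurableSet] at h0
    rw [ae_restrict_iff' hU.measurableSet]
    filter_upwards [h0] with x hx hx2 using hx hx2.1 hx2.2
  have := hU.ae_eq_zero_of_integral_contDiff_smul_eq_zero (μ := volume) hm.2.1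
    fun ψ hψ hc hs => by
      have hint : IntegrableOn (fun x => ψ x • w x) (G \ K) := by
        have hk : IntegrableOn w (tsupport ψ) := hm.2.1.integrableOn_compact_subset hs hc
        refine (hk.continuousOn_smul hψ.continuous.continuousOn hc).of_ae_sdiff_eq_zero
          hU.measurableSet.nullMeasurableSet (Eventually.of_forall fun x hx => ?_)
        rw [image_eq_zero_of_notMem_tsupport hx.2, zero_smul]
      rw [← setIntegral_eq_integral_of_forall_compl_eq_zero (s := G \ K)]
      · refine ext_inner_left ℝ fun e => ?_
        rw [inner_zero_right, ← integral_inner hint]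
        have h1 := hm.2.2 ψ hψ hc hs e
        rw [integral_eq_zero_of_ae] at h1
        · rw [← neg_eq_zero, h1]
          congr 2; ext x
          rw [real_inner_smul_right, real_inner_comm, mul_comm]
        · filter_upwards [h0'] with x hx
          simp [hx]
      · intro x hx
        rw [image_eq_zero_of_notMem_tsupport fun h => hx (hs h), zero_smul]
  rw [ae_restrict_iff' hG.measurableSet]
  filter_upwards [this] with x hx hxG hxK using hx ⟨hxG, hxK⟩

/-! ### Integration by parts and classical sub- and super-harmonics -/

/-- The divergence of a vector field. -/
noncomputable def divergence (X : Euc N → Euc N) (x : Euc N) : ℝ :=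
  ∑ i, fderiv ℝ X x (EuclideanSpace.single i 1) i

lemma continuous_bdryDist (Ω : Set (Euc N)) : Continuous (bdryDist Ω) :=
  Metric.continuous_infDist_pt _

lemma continuousOn_divergence_term {G : Set (Euc N)} (hG : IsOpen G) {X : Euc N → Euc N}
    (hX : ContDiffOn ℝ 1 X G) (i : Fin N) :
    ContinuousOn (fun x => fderiv ℝ X x (EuclideanSpace.single i 1) i) G := by
  have h := (hX.continuousOn_fderiv_of_isOpen hG le_rfl).clm_apply
    (continuousOn_const (c := (EuclideanSpace.single i (1 : ℝ) : Euc N)))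
  exact (EuclideanSpace.proj (𝕜 := ℝ) i).continuous.comp_continuousOn h

lemma continuousOn_divergence {G : Set (Euc N)} (hG : IsOpen G) {X : Euc N → Euc N}
    (hX : ContDiffOn ℝ 1 X G) : ContinuousOn (divergence X) G :=
  continuousOn_finsetSum _ fun i _ => continuousOn_divergence_term hG hX i

lemma inner_single_one (w : Euc N) (i : Fin N) :
    inner ℝ w (EuclideanSpace.single i (1 : ℝ)) = w i := by
  rw [EuclideanSpace.inner_single_right]; simp

lemma HasWeakGradient.locallyIntegrableOn_apply {G : Set (Euc N)} {v : Euc N → ℝ}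
    {w : Euc N → Euc N} (h : HasWeakGradient G v w) (i : Fin N) :
    LocallyIntegrableOn (fun x => w x i) G := by
  have := LocallyIntegrableOn.inner_right h.2.1 (EuclideanSpace.single i 1)
  simpa only [inner_single_one] using this

/-- Integration by parts against a vector field of class `C^1`. -/
lemma MemH1Compact.integral_inner {G : Set (Euc N)} (hG : IsOpen G) {v : Euc N → ℝ}
    {w : Euc N → Euc N} (h : MemH1Compact G v w) {X : Euc N → Euc N} (hX : ContDiffOn ℝ 1 X G) :
    ∫ x in G, inner ℝ (X x) (w x) = -∫ x in G, v x * divergence X x := by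
  obtain ⟨hw, -, -, K, hK, hKG, h0⟩ := h
  have hw0 := hw.ae_eq_zero hG hK.isClosed h0
  -- The identity for `v` is tested with `χ Xᵢ`. It agrees with `Xᵢ` near `K`, and off `K` both `v`
  -- and its weak gradient vanish almost everywhere, so the cutoff disappears from the result.
  obtain ⟨χ, hχ, hχc, hχG, hχ1⟩ := exists_smooth_cutoff hK hG hKG
  have hXi : ∀ i, ContDiffOn ℝ 1 (fun x => X x i) G := fun i =>
    (EuclideanSpace.proj (𝕜 := ℝ) i).contDiff.comp_contDiffOn hX
  have hχ' : ContDiff ℝ 1 χ := hχ.of_le (by exact_mod_cast le_top)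
  have key : ∀ i, ∫ x in G, w x i * X x i
      = -∫ x in G, v x * fderiv ℝ X x (EuclideanSpace.single i 1) i := fun i => by
    have := hw.integral_mul_fderiv hG (contDiff_mul_of_tsupport hG (hXi i) hχ' hχG)
      hχc.mul_left (tsupport_mul_subset_right'.trans hχG) (EuclideanSpace.single i 1)
    rw [eq_neg_iff_add_eq_zero, add_comm, ← eq_neg_iff_add_eq_zero]
    convert this using 1
    · refine integral_congr_ae ?_
      filter_upwards [h0, ae_restrict_mem hG.measurableSet] with x hx hxG
      by_cases hxK : x ∈ K
      · have e1 : (fun y => X y i * χ y) =ᶠ[𝓝 x] fun y => X y i := by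
          filter_upwards [hχ1 x hxK] with y hy
          simp [hy]
        have e2 : HasFDerivAt (fun y => X y i) ((EuclideanSpace.proj (𝕜 := ℝ) i).comp (fderiv ℝ X x)) x :=
          (EuclideanSpace.proj (𝕜 := ℝ) i).hasFDerivAt.comp x
            ((hX.contDiffAt (hG.mem_nhds hxG)).differentiableAt one_ne_zero).hasFDerivAt
        rw [e1.fderiv_eq, e2.fderiv]
        simp
      · simp [hx hxK]
    · congr 1
      refine integral_congr_ae ?_
      filter_upwards [hw0] with x hx
      by_cases hxK : x ∈ K
      · rw [inner_single_one, (hχ1 x hxK).eq_of_nhds, Pi.one_apply, mul_one]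
      · simp [hx hxK]
  have i1 : ∀ i, IntegrableOn (fun x => w x i * X x i) G := fun i => by
    refine integrableOn_mul_of_ae_eq_zero hG hK hKG (hw.locallyIntegrableOn_apply i)
      (hXi i).continuousOn ?_
    filter_upwards [hw0] with x hx hxK
    simp [hx hxK]
  have i2 : ∀ i, IntegrableOn (fun x => v x * fderiv ℝ X x (EuclideanSpace.single i 1) i) G :=
    fun i => by
    refine integrableOn_mul_of_ae_eq_zero hG hK hKG hw.1
      (continuousOn_divergence_term hG hX i) ?_
    filter_upwards [h0] with x hx hxK
    simp [hx hxK]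
  simp_rw [divergence, Finset.mul_sum]
  rw [integral_finsetSum _ fun i _ => i2 i, ← Finset.sum_neg_distrib]
  simp_rw [← key]
  rw [← integral_finsetSum _ fun i _ => i1 i]
  congr 1

lemma memH1Loc_of_hasGradientAt {G : Set (Euc N)} (hG : IsOpen G) {H : Euc N → ℝ}
    {X : Euc N → Euc N} (hH : ∀ x ∈ G, HasGradientAt H (X x) x) (hX : ContinuousOn X G) :
    MemH1Loc G H X := by
  have hHc : ContinuousOn H G := (contDiffOn_of_hasGradientAt hG hH hX).continuousOn
  refine ⟨⟨hHc.locallyIntegrableOn hG.measurableSet, hX.locallyIntegrableOn hG.measurableSet,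
    fun ψ hψ hc hs e => ?_⟩, fun K hK hKG => ?_⟩
  · have hψ1 : ContDiff ℝ 1 ψ := hψ.of_le (by exact_mod_cast le_top)
    have hdψ : Continuous fun x => fderiv ℝ ψ x e :=
      (hψ1.continuous_fderiv one_ne_zero).clm_apply continuous_const
    have hfd : ∀ x ∈ G, fderiv ℝ H x e = inner ℝ (X x) e := fun x hx => by
      rw [(hH x hx).hasFDerivAt.fderiv]; simp
    have haux : ∀ {a b : Euc N → ℝ}, ContinuousOn a G → Continuous b → tsupport b ⊆ tsupport ψ →
        Integrable (fun x => a x * b x) := fun {a b} ha hb hab => by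
      have h1 := integrableOn_mul_of_tsupport hG (ha.locallyIntegrableOn hG.measurableSet)
        hb.continuousOn (hc.of_isClosed_subset (isClosed_tsupport _) hab) (hab.trans hs)
      rw [← integrableOn_univ]
      refine h1.of_forall_sdiff_eq_zero MeasurableSet.univ fun x hx => ?_
      rw [image_eq_zero_of_notMem_tsupport fun h => hx.2 (hs (hab h)), mul_zero]
    rw [setIntegral_eq_integral_of_forall_compl_eq_zero,
      setIntegral_eq_integral_of_forall_compl_eq_zero,
      integral_mul_fderiv_eq_neg_fderiv_mul_of_integrable]
    · congr 2; ext x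
      by_cases hx : x ∈ G
      · rw [hfd x hx]
      · rw [image_eq_zero_of_notMem_tsupport fun h => hx (hs h)]; simp
    · refine (haux (hX.inner (continuousOn_const (c := e))) hψ.continuous Subset.rfl).congr
        (Eventually.of_forall fun x => ?_)
      by_cases hx : x ∈ G
      · simp only [hfd x hx]
      · simp [image_eq_zero_of_notMem_tsupport fun h => hx (hs h)]
    · exact haux hHc hdψ (tsupport_fderiv_apply_subset ℝ e)
    · exact haux hHc hψ.continuous Subset.rfl
    · exact fun x hx => (hH x (hs hx)).hasFDerivAt.differentiableAt
    · exact fun x _ => hψ1.differentiable one_ne_zero x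
    · intro x hx
      rw [image_eq_zero_of_notMem_tsupport fun h => hx (hs h), mul_zero]
    · intro x hx
      rw [fderiv_apply_eq_zero fun h => hx (hs h), mul_zero]
  · have := hK.measure_lt_top (μ := (volume : Measure (Euc N)))
    have : IsFiniteMeasure ((volume : Measure (Euc N)).restrict K) := ⟨by simpa using this⟩
    obtain ⟨A, hA⟩ := hK.exists_bound_of_continuousOn (hHc.mono hKG)
    obtain ⟨B, hB⟩ := hK.exists_bound_of_continuousOn (hX.mono hKG)
    exact ⟨MemLp.of_bound ((hHc.mono hKG).aestronglyMeasurable hK.measurableSet) A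
        (ae_restrict_of_forall_mem hK.measurableSet hA),
      MemLp.of_bound ((hX.mono hKG).aestronglyMeasurable hK.measurableSet) B
        (ae_restrict_of_forall_mem hK.measurableSet hB)⟩

lemma continuousOn_potential {Ω G : Set (Euc N)} (μ : ℝ) (hδ : ∀ x ∈ G, 0 < bdryDist Ω x) :
    ContinuousOn (fun x => μ / bdryDist Ω x ^ 2) G :=
  continuousOn_const.div ((continuous_bdryDist Ω).pow 2).continuousOn
    fun x hx => (pow_pos (hδ x hx) 2).ne'

/-- The weak form of a function of class `C^2` is given by the pointwise operator. -/
lemma hardyForm_eq_integral {Ω G : Set (Euc N)} {μ : ℝ} (hG : IsOpen G)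
    (hδ : ∀ x ∈ G, 0 < bdryDist Ω x) {H : Euc N → ℝ} {X : Euc N → Euc N}
    (hH : ∀ x ∈ G, HasGradientAt H (X x) x) (hX : ContDiffOn ℝ 1 X G)
    {v : Euc N → ℝ} {w : Euc N → Euc N} (h : MemH1Compact G v w) :
    IntegrableOn (fun x => v x * (-divergence X x - μ / bdryDist Ω x ^ 2 * H x)) G ∧
    hardyForm Ω μ G H X v w
      = ∫ x in G, v x * (-divergence X x - μ / bdryDist Ω x ^ 2 * H x) := by
  have hHc : ContinuousOn H G := (contDiffOn_of_hasGradientAt hG hH hX.continuousOn).continuousOn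
  have hV := (continuousOn_potential μ hδ).mul hHc
  have hd := continuousOn_divergence hG hX
  obtain ⟨K, hK, hKG, h0⟩ := h.2.2.2
  have haux : ∀ {θ : Euc N → ℝ}, ContinuousOn θ G → IntegrableOn (fun x => v x * θ x) G :=
    fun {θ} hθ => by
      refine integrableOn_mul_of_ae_eq_zero hG hK hKG h.1.1 hθ ?_
      filter_upwards [h0] with x hx hxK
      simp [hx hxK]
  refine ⟨haux (hd.neg.sub hV), ?_⟩
  rw [hardyForm, h.integral_inner hG hX, ← integral_neg]
  have i1 : IntegrableOn (fun x => -(v x * divergence X x)) G := (haux hd).neg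
  have i2 : IntegrableOn (fun x => μ / bdryDist Ω x ^ 2 * H x * v x) G :=
    (haux hV).congr (Eventually.of_forall fun x => mul_comm _ _)
  rw [← integral_sub i1 i2]
  congr 1; ext x; ring

lemma isSuperharmonic_of_hasGradientAt {Ω G : Set (Euc N)} {μ : ℝ} (hG : IsOpen G)
    (hδ : ∀ x ∈ G, 0 < bdryDist Ω x) {H : Euc N → ℝ} {X : Euc N → Euc N}
    (hH : ∀ x ∈ G, HasGradientAt H (X x) x) (hX : ContDiffOn ℝ 1 X G)
    (hP : ∀ x ∈ G, 0 ≤ -divergence X x - μ / bdryDist Ω x ^ 2 * H x) :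
    IsSuperharmonic Ω μ G H := by
  refine ⟨(contDiffOn_of_hasGradientAt hG hH hX.continuousOn).continuousOn, X,
    memH1Loc_of_hasGradientAt hG hH hX.continuousOn, fun v w h hv => ?_⟩
  rw [(hardyForm_eq_integral hG hδ hH hX h).2]
  refine integral_nonneg_of_ae ?_
  filter_upwards [hv, ae_restrict_mem hG.measurableSet] with x hx hxG
    using mul_nonneg hx (hP x hxG)

lemma isSubharmonic_of_hasGradientAt {Ω G : Set (Euc N)} {μ : ℝ} (hG : IsOpen G)
    (hδ : ∀ x ∈ G, 0 < bdryDist Ω x) {H : Euc N → ℝ} {X : Euc N → Euc N}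
    (hH : ∀ x ∈ G, HasGradientAt H (X x) x) (hX : ContDiffOn ℝ 1 X G)
    (hP : ∀ x ∈ G, -divergence X x - μ / bdryDist Ω x ^ 2 * H x ≤ 0) :
    IsSubharmonic Ω μ G H := by
  refine ⟨(contDiffOn_of_hasGradientAt hG hH hX.continuousOn).continuousOn, X,
    memH1Loc_of_hasGradientAt hG hH hX.continuousOn, fun v w h hv => ?_⟩
  rw [(hardyForm_eq_integral hG hδ hH hX h).2]
  refine integral_nonpos_of_ae ?_
  filter_upwards [hv, ae_restrict_mem hG.measurableSet] with x hx hxG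
    using mul_nonpos_of_nonneg_of_nonpos hx (hP x hxG)

/-! ### Restriction and linear combination of sub- and super-harmonics -/

lemma setIntegral_eq_of_eq_indicator {G G' : Set (Euc N)} (hG' : IsOpen G') (hsub : G' ⊆ G)
    {F F' : Euc N → ℝ} (hF : F = G'.indicator F') : ∫ x in G, F x = ∫ x in G', F' x := by
  rw [hF, setIntegral_indicator hG'.measurableSet, inter_eq_self_of_subset_right hsub]

/-- Extension by zero creates no jump, because the function and its weak gradient vanish off a
compact subset of `G'`: a test function in `G` may be cut off to one in `G'`. Test functions thus
pass to larger sets, and sub- and super-harmonicity to smaller ones. -/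
lemma MemH1Compact.indicator {G G' : Set (Euc N)} (hG' : IsOpen G')
    (hsub : G' ⊆ G) {v : Euc N → ℝ} {w : Euc N → Euc N} (h : MemH1Compact G' v w) :
    MemH1Compact G (G'.indicator v) (G'.indicator w) := by
  obtain ⟨hw, hv2, hw2, K, hK, hKG, h0⟩ := h
  have hw0 := hw.ae_eq_zero hG' hK.isClosed h0
  have hm := hG'.measurableSet
  have hvi : IntegrableOn v G' := by
    refine (hw.1.integrableOn_compact_subset hKG hK).of_ae_sdiff_eq_zero hm.nullMeasurableSet ?_
    rw [ae_restrict_iff' hm] at h0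
    filter_upwards [h0] with x hx hx2 using hx hx2.1 hx2.2
  have hwi : IntegrableOn w G' := by
    refine (hw.2.1.integrableOn_compact_subset hKG hK).of_ae_sdiff_eq_zero hm.nullMeasurableSet ?_
    rw [ae_restrict_iff' hm] at hw0
    filter_upwards [hw0] with x hx hx2 using hx hx2.1 hx2.2
  refine ⟨⟨(hvi.integrable_indicator hm).locallyIntegrable.locallyIntegrableOn G,
    (hwi.integrable_indicator hm).locallyIntegrable.locallyIntegrableOn G,
    fun ψ hψ hc hs e => ?_⟩, ?_, ?_, K, hK, hKG.trans hsub, ?_⟩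
  · obtain ⟨χ, hχ, hχc, hχG, hχ1⟩ := exists_smooth_cutoff hK hG' hKG
    have key := hw.2.2 (fun x => ψ x * χ x) (hψ.mul hχ) hχc.mul_left
      (tsupport_mul_subset_right'.trans hχG) e
    rw [setIntegral_eq_of_eq_indicator hG' hsub (F' := fun x => v x * fderiv ℝ ψ x e),
      setIntegral_eq_of_eq_indicator hG' hsub (F' := fun x => inner ℝ (w x) e * ψ x)]
    · convert key using 1
      · refine integral_congr_ae ?_
        filter_upwards [h0] with x hx
        by_cases hxK : x ∈ K
        · have e1 : (fun y => ψ y * χ y) =ᶠ[𝓝 x] ψ := by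
            filter_upwards [hχ1 x hxK] with y hy
            simp [hy]
          rw [e1.fderiv_eq]
        · simp [hx hxK]
      · congr 1
        refine integral_congr_ae ?_
        filter_upwards [hw0] with x hx
        by_cases hxK : x ∈ K
        · simp [(hχ1 x hxK).eq_of_nhds]
        · simp [hx hxK]
    · ext x
      by_cases hx : x ∈ G' <;> simp [hx]
    · ext x
      by_cases hx : x ∈ G' <;> simp [hx]
  · exact ((memLp_indicator_iff_restrict hm).2 hv2).restrict G
  · exact ((memLp_indicator_iff_restrict hm).2 hw2).restrict G
  · rw [ae_restrict_iff' hm] at h0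
    filter_upwards [ae_restrict_of_ae h0] with x hx hxK
    by_cases hxG : x ∈ G'
    · simpa [hxG] using hx hxG hxK
    · simp [hxG]

lemma hardyForm_indicator {Ω G G' : Set (Euc N)} {μ : ℝ} (hG' : IsOpen G') (hsub : G' ⊆ G)
    (u v : Euc N → ℝ) (g w : Euc N → Euc N) :
    hardyForm Ω μ G u g (G'.indicator v) (G'.indicator w) = hardyForm Ω μ G' u g v w := by
  unfold hardyForm
  rw [setIntegral_eq_of_eq_indicator hG' hsub (F' := fun x => inner ℝ (g x) (w x)),
    setIntegral_eq_of_eq_indicator hG' hsub (F' := fun x => μ / bdryDist Ω x ^ 2 * u x * v x)]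
  · ext x
    by_cases hx : x ∈ G' <;> simp [hx]
  · ext x
    by_cases hx : x ∈ G' <;> simp [hx]

lemma indicator_ae_nonneg {G G' : Set (Euc N)} (hG' : IsOpen G') {v : Euc N → ℝ}
    (hv : ∀ᵐ x ∂volume.restrict G', 0 ≤ v x) :
    ∀ᵐ x ∂volume.restrict G, 0 ≤ G'.indicator v x := by
  rw [ae_restrict_iff' hG'.measurableSet] at hv
  filter_upwards [ae_restrict_of_ae hv] with x hx
  exact indicator_apply_nonneg hx

lemma MemH1Loc.mono {G G' : Set (Euc N)} {u : Euc N → ℝ} {g : Euc N → Euc N}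
    (h : MemH1Loc G u g) (hsub : G' ⊆ G) (hG : IsOpen G) : MemH1Loc G' u g :=
  ⟨h.1.mono hsub hG, fun K hK hKG => h.2 K hK (hKG.trans hsub)⟩

lemma IsSubharmonic.mono {Ω G G' : Set (Euc N)} {μ : ℝ} {u : Euc N → ℝ}
    (h : IsSubharmonic Ω μ G u) (hG : IsOpen G) (hG' : IsOpen G') (hsub : G' ⊆ G) :
    IsSubharmonic Ω μ G' u := by
  obtain ⟨hc, g, hg, ht⟩ := h
  refine ⟨hc.mono hsub, g, hg.mono hsub hG, fun v w hvw hv => ?_⟩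
  rw [← hardyForm_indicator hG' hsub]
  exact ht _ _ (hvw.indicator hG' hsub) (indicator_ae_nonneg hG' hv)

lemma IsSuperharmonic.mono {Ω G G' : Set (Euc N)} {μ : ℝ} {u : Euc N → ℝ}
    (h : IsSuperharmonic Ω μ G u) (hG : IsOpen G) (hG' : IsOpen G') (hsub : G' ⊆ G) :
    IsSuperharmonic Ω μ G' u := by
  obtain ⟨hc, g, hg, ht⟩ := h
  refine ⟨hc.mono hsub, g, hg.mono hsub hG, fun v w hvw hv => ?_⟩
  rw [← hardyForm_indicator hG' hsub]
  exact ht _ _ (hvw.indicator hG' hsub) (indicator_ae_nonneg hG' hv)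

/-- Both factors are square integrable on the compact set carrying `v`, where the potential is
bounded. Integrability is needed to use additivity of the integrals, which take the default value
`0` on non-integrable functions. -/
lemma integrableOn_form {Ω G : Set (Euc N)} {μ : ℝ} (hG : IsOpen G)
    (hδ : ∀ x ∈ G, 0 < bdryDist Ω x) {u v : Euc N → ℝ} {g w : Euc N → Euc N}
    (hu : MemH1Loc G u g) (h : MemH1Compact G v w) :
    IntegrableOn (fun x => inner ℝ (g x) (w x)) G ∧
      IntegrableOn (fun x => μ / bdryDist Ω x ^ 2 * u x * v x) G := by
  obtain ⟨hw, hv2, hw2, K, hK, hKG, h0⟩ := h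
  have hw0 := hw.ae_eq_zero hG hK.isClosed h0
  obtain ⟨hu2, hg2⟩ := hu.2 K hK hKG
  have hv2K := hv2.mono_measure (Measure.restrict_mono hKG le_rfl)
  have hw2K := hw2.mono_measure (Measure.restrict_mono hKG le_rfl)
  have hm := hG.measurableSet
  rw [ae_restrict_iff' hm] at h0 hw0
  constructor
  · have h1 : IntegrableOn (fun x => inner ℝ (g x) (w x)) K := by
      refine (hg2.norm.integrable_mul hw2K.norm).mono
        (hg2.aestronglyMeasurable.inner hw2K.aestronglyMeasurable) (Eventually.of_forall fun x => ?_)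
      simpa using abs_real_inner_le_norm (g x) (w x)
    refine h1.of_ae_sdiff_eq_zero hm.nullMeasurableSet ?_
    filter_upwards [hw0] with x hx hx2
    simp [hx hx2.1 hx2.2]
  · have h1 : IntegrableOn (fun x => u x * v x) K := hu2.integrable_mul hv2K
    have h2 : IntegrableOn (fun x => μ / bdryDist Ω x ^ 2 * u x * v x) K :=
      (h1.continuousOn_mul ((continuousOn_potential μ hδ).mono hKG) hK).congr
        (Eventually.of_forall fun x => by ring)
    refine h2.of_ae_sdiff_eq_zero hm.nullMeasurableSet ?_
    filter_upwards [h0] with x hx hx2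
    simp [hx hx2.1 hx2.2]

lemma MemH1Loc.sub_smul {G : Set (Euc N)} (hG : IsOpen G) {u h : Euc N → ℝ} {g k : Euc N → Euc N}
    (hu : MemH1Loc G u g) (hh : MemH1Loc G h k) (c : ℝ) :
    MemH1Loc G (fun x => u x - c * h x) (fun x => g x - c • k x) := by
  have l1 : LocallyIntegrableOn (fun x => c * h x) G := hh.1.1.smul c
  have l2 : LocallyIntegrableOn (fun x => c • k x) G := hh.1.2.1.smul c
  refine ⟨⟨hu.1.1.sub l1, hu.1.2.1.sub l2, fun ψ hψ hc hs e => ?_⟩,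
    fun K hK hKG => ⟨(hu.2 K hK hKG).1.sub ((hh.2 K hK hKG).1.const_mul c),
      (hu.2 K hK hKG).2.sub ((hh.2 K hK hKG).2.const_smul c)⟩⟩
  have hdψ : Continuous fun x => fderiv ℝ ψ x e :=
    (hψ.continuous_fderiv (by simp)).clm_apply continuous_const
  have a1 : ∀ f : Euc N → ℝ, LocallyIntegrableOn f G →
      IntegrableOn (fun x => f x * fderiv ℝ ψ x e) G := fun f hf =>
    integrableOn_mul_of_tsupport hG hf hdψ.continuousOn (hc.fderiv_apply (𝕜 := ℝ) e)
      ((tsupport_fderiv_apply_subset ℝ e).trans hs)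
  have a2 : ∀ f : Euc N → ℝ, LocallyIntegrableOn f G →
      IntegrableOn (fun x => f x * ψ x) G := fun f hf =>
    integrableOn_mul_of_tsupport hG hf hψ.continuous.continuousOn hc hs
  have i1 := a1 _ hu.1.1
  have i2 := a1 _ hh.1.1
  have i3 := a2 _ (LocallyIntegrableOn.inner_right hu.1.2.1 e)
  have i4 := a2 _ (LocallyIntegrableOn.inner_right hh.1.2.1 e)
  calc ∫ x in G, (u x - c * h x) * fderiv ℝ ψ x e
      = ∫ x in G, (u x * fderiv ℝ ψ x e - c * (h x * fderiv ℝ ψ x e)) := by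
        congr 1; ext x; ring
    _ = (∫ x in G, u x * fderiv ℝ ψ x e) - c * ∫ x in G, h x * fderiv ℝ ψ x e := by
        rw [integral_sub i1 (i2.const_mul c), integral_const_mul]
    _ = -((∫ x in G, inner ℝ (g x) e * ψ x) - c * ∫ x in G, inner ℝ (k x) e * ψ x) := by
        rw [hu.1.2.2 ψ hψ hc hs e, hh.1.2.2 ψ hψ hc hs e]; ring
    _ = -∫ x in G, inner ℝ (g x - c • k x) e * ψ x := by
        rw [← integral_const_mul, ← integral_sub i3 (i4.const_mul c)]
        congr 2; ext x
        rw [inner_sub_left, real_inner_smul_left]; ring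

lemma IsSubharmonic.sub_smul {Ω G : Set (Euc N)} {μ : ℝ} (hG : IsOpen G)
    (hδ : ∀ x ∈ G, 0 < bdryDist Ω x) {u h : Euc N → ℝ}
    (hu : IsSubharmonic Ω μ G u) (hh : IsSuperharmonic Ω μ G h) {c : ℝ} (hc : 0 ≤ c) :
    IsSubharmonic Ω μ G (fun x => u x - c * h x) := by
  obtain ⟨huc, g, hg, hu⟩ := hu
  obtain ⟨hhc, k, hk, hh⟩ := hh
  refine ⟨huc.sub (hhc.const_mul c), _, hg.sub_smul hG hk c, fun v w hvw hv => ?_⟩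
  have h1 := hu v w hvw hv
  have h2 := mul_nonneg hc (hh v w hvw hv)
  obtain ⟨i1, i2⟩ := integrableOn_form (μ := μ) hG hδ hg hvw
  obtain ⟨i3, i4⟩ := integrableOn_form (μ := μ) hG hδ hk hvw
  have e1 : ∫ x in G, inner ℝ (g x - c • k x) (w x)
      = (∫ x in G, inner ℝ (g x) (w x)) - c * ∫ x in G, inner ℝ (k x) (w x) := by
    rw [← integral_const_mul, ← integral_sub i1 (i3.const_mul c)]
    congr 1; ext x
    rw [inner_sub_left, real_inner_smul_left]
  have e2 : ∫ x in G, μ / bdryDist Ω x ^ 2 * (u x - c * h x) * v x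
      = (∫ x in G, μ / bdryDist Ω x ^ 2 * u x * v x)
        - c * ∫ x in G, μ / bdryDist Ω x ^ 2 * h x * v x := by
    rw [← integral_const_mul, ← integral_sub i2 (i4.const_mul c)]
    congr 1; ext x; ring
  unfold hardyForm at *
  rw [e1, e2]
  linarith

/-! ### The comparison principle -/

lemma HasGradientAt.scomp {H : Euc N → ℝ} {X x : Euc N} {f : ℝ → ℝ} {f' : ℝ}
    (hf : HasDerivAt f f' (H x)) (hH : HasGradientAt H X x) :
    HasGradientAt (fun y => f (H y)) (f' • X) x := by
  rw [hasGradientAt_iff_hasFDerivAt] at *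
  have := hf.comp_hasFDerivAt x hH
  rw [map_smul]
  exact this

/-- From the second power on, the positive part is of class `C^1`, also at `0`. Using squares and
cubes of `u₊` in the test functions lets the `C^1` chain rule suffice. -/
lemma hasDerivAt_max_zero_pow (n : ℕ) (s : ℝ) :
    HasDerivAt (fun s : ℝ => max s 0 ^ (n + 2)) ((n + 2) * max s 0 ^ (n + 1)) s := by
  rcases lt_trichotomy s 0 with h | h | h
  · rw [max_eq_right h.le]
    simp only [ne_eq, Nat.add_eq_zero_iff, one_ne_zero, and_false, not_false_eq_true, zero_pow,
      mul_zero]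
    refine (hasDerivAt_const s (0 : ℝ)).congr_of_eventuallyEq ?_
    filter_upwards [gt_mem_nhds h] with t ht
    simp [max_eq_right (le_of_lt ht)]
  · subst h
    simp only [max_self, ne_eq, Nat.add_eq_zero_iff, one_ne_zero, and_false, not_false_eq_true,
      zero_pow, mul_zero]
    rw [hasDerivAt_iff_isLittleO]
    simp only [max_self, ne_eq, Nat.add_eq_zero_iff, OfNat.ofNat_ne_zero, and_false,
      not_false_eq_true, zero_pow, sub_zero, smul_zero]
    refine Asymptotics.IsBigO.trans_isLittleO (g := fun s : ℝ => s ^ (n + 2)) ?_ ?_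
    · refine Asymptotics.IsBigO.of_bound 1 (Eventually.of_forall fun t => ?_)
      rw [one_mul, norm_pow, norm_pow]
      refine pow_le_pow_left₀ (norm_nonneg _) ?_ _
      rw [Real.norm_of_nonneg (le_max_right _ _), Real.norm_eq_abs]
      exact max_le (le_abs_self t) (abs_nonneg t)
    · simpa using Asymptotics.isLittleO_pow_id (𝕜 := ℝ) (n := n + 2) (by omega)
  · rw [max_eq_left h.le]
    have := hasDerivAt_pow (n + 2) s
    refine HasDerivAt.congr_of_eventuallyEq (f := fun s => s ^ (n + 2)) (by simpa using this) ?_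
    filter_upwards [lt_mem_nhds h] with t ht
    rw [max_eq_left (le_of_lt ht)]

lemma deriv_max_zero_pow (n : ℕ) :
    deriv (fun s : ℝ => max s 0 ^ (n + 2)) = fun s => ((n : ℝ) + 2) * max s 0 ^ (n + 1) :=
  funext fun s => (hasDerivAt_max_zero_pow n s).deriv

lemma contDiff_max_zero_pow (n : ℕ) : ContDiff ℝ 1 (fun s : ℝ => max s 0 ^ (n + 2)) := by
  rw [contDiff_one_iff_deriv]
  refine ⟨fun s => (hasDerivAt_max_zero_pow n s).differentiableAt, ?_⟩
  rw [deriv_max_zero_pow]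
  fun_prop

lemma memLp_smul_of_continuousOn {K : Set (Euc N)} (hK : IsCompact K) {f : Euc N → ℝ}
    {g : Euc N → Euc N} (hf : ContinuousOn f K) (hg : MemLp g 2 (volume.restrict K)) :
    MemLp (fun x => f x • g x) 2 (volume.restrict K) := by
  obtain ⟨C, hC⟩ := hK.exists_bound_of_continuousOn hf
  refine hg.of_le_mul (c := C) ((hf.aestronglyMeasurable hK.measurableSet).smul
    hg.aestronglyMeasurable) (ae_restrict_of_forall_mem hK.measurableSet fun x hx => ?_)
  rw [norm_smul]
  exact mul_le_mul_of_nonneg_right (hC x hx) (norm_nonneg _)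

lemma memLp_restrict_of_eq_zero {F : Type*} [NormedAddCommGroup F] {G K : Set (Euc N)}
    (hG : IsOpen G) (hK : IsCompact K) (hKG : K ⊆ G) {f : Euc N → F}
    (hf : MemLp f 2 (volume.restrict K)) (h0 : ∀ x ∈ G, x ∉ K → f x = 0) :
    MemLp f 2 (volume.restrict G) := by
  rw [← memLp_indicator_iff_restrict hK.measurableSet] at hf
  rw [← memLp_indicator_iff_restrict hG.measurableSet]
  convert hf using 1
  ext x
  by_cases hx : x ∈ K
  · simp [hx, hKG hx]
  · by_cases hxG : x ∈ G
    · simp [hx, hxG, h0 x hxG hx]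
    · simp [hx, hxG]

lemma memLp_two_of_continuousOn {F : Type*} [NormedAddCommGroup F] {K : Set (Euc N)}
    (hK : IsCompact K) {f : Euc N → F} [SecondCountableTopologyEither (Euc N) F]
    (hf : ContinuousOn f K) : MemLp f 2 (volume.restrict K) := by
  have := hK.measure_lt_top (μ := (volume : Measure (Euc N)))
  have : IsFiniteMeasure ((volume : Measure (Euc N)).restrict K) := ⟨by simpa using this⟩
  obtain ⟨A, hA⟩ := hK.exists_bound_of_continuousOn hf
  exact MemLp.of_bound (hf.aestronglyMeasurable_of_isCompact hK hK.measurableSet) A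
    (ae_restrict_of_forall_mem hK.measurableSet hA)

/-- Functions `q · η(u)`, with `η` vanishing on `(-∞, 0]` and `u` non-positive away from a compact
set, are admissible test functions. -/
lemma memH1Compact_mul_comp {G K : Set (Euc N)} (hG : IsOpen G) (hK : IsCompact K) (hKG : K ⊆ G)
    {u : Euc N → ℝ} {g : Euc N → Euc N} (hcu : ContinuousOn u G) (hu : MemH1Loc G u g)
    (huK : ∀ x ∈ G, x ∉ K → u x ≤ 0) {η : ℝ → ℝ} (hη : ContDiff ℝ 1 η)
    (hη0 : ∀ s ≤ 0, η s = 0 ∧ deriv η s = 0) {q : Euc N → ℝ} {Y : Euc N → Euc N}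
    (hq : ∀ x ∈ G, HasGradientAt q (Y x) x) (hY : ContinuousOn Y G) :
    MemH1Compact G (fun x => q x * η (u x))
      (fun x => q x • deriv η (u x) • g x + η (u x) • Y x) := by
  have hqc : ContinuousOn q G := (contDiffOn_of_hasGradientAt hG hq hY).continuousOn
  have hηc : ContinuousOn (fun x => η (u x)) G := hη.continuous.comp_continuousOn hcu
  have hη'c : ContinuousOn (fun x => deriv η (u x)) G :=
    (hη.continuous_deriv le_rfl).comp_continuousOn hcu
  refine ⟨(hu.1.comp hG hcu hη).mul hG hq hY, ?_, ?_, K, hK, hKG, ?_⟩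
  · refine memLp_restrict_of_eq_zero hG hK hKG
      (memLp_two_of_continuousOn hK ((hqc.mul hηc).mono hKG)) fun x hx hxK => ?_
    simp [(hη0 _ (huK x hx hxK)).1]
  · refine memLp_restrict_of_eq_zero hG hK hKG (MemLp.add ?_ ?_) fun x hx hxK => ?_
    · exact memLp_smul_of_continuousOn hK (hqc.mono hKG)
        (memLp_smul_of_continuousOn hK (hη'c.mono hKG) (hu.2 K hK hKG).2)
    · exact memLp_two_of_continuousOn hK ((hηc.smul hY).mono hKG)
    · simp [(hη0 _ (huK x hx hxK)).1, (hη0 _ (huK x hx hxK)).2]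
  · filter_upwards [ae_restrict_mem hG.measurableSet] with x hx hxK
    simp [(hη0 _ (huK x hx hxK)).1]

lemma nonpos_of_ae_nonpos {G : Set (Euc N)} (hG : IsOpen G) {u : Euc N → ℝ}
    (hcu : ContinuousOn u G) (h : ∀ᵐ x ∂volume.restrict G, u x ≤ 0) : ∀ x ∈ G, u x ≤ 0 := by
  by_contra! hcon
  obtain ⟨x, hx, hux⟩ := hcon
  have hopen : IsOpen (G ∩ u ⁻¹' Ioi 0) := hcu.isOpen_inter_preimage hG isOpen_Ioi
  have hpos := hopen.measure_pos volume ⟨x, hx, hux⟩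
  rw [ae_restrict_iff' hG.measurableSet, ae_iff] at h
  refine hpos.ne' (measure_mono_null ?_ h)
  rintro y ⟨hy, hy2⟩
  simpa [hy] using hy2

/-- A Picone-type identity. With `a = H`, `t = u₊`, `g = ∇u` and `X = ∇H`, the vectors paired with
`g` and `X` are the gradients of `u₊²/H` and `u₊³/H²`; the mixed terms add up to complete the
square. -/
lemma inner_test_gradients {a t : ℝ} (ha : 0 < a) (g X : Euc N) :
    inner ℝ g ((1 / a) • ((2 : ℝ) * t) • g + t ^ 2 • (-(1 / a ^ 2)) • X)
      - inner ℝ X ((1 / a ^ 2) • ((3 : ℝ) * t ^ 2) • g + t ^ 3 • (-(2 / a ^ 3)) • X)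
      = 2 * t / a * ‖g - (t / a) • X‖ ^ 2 := by
  rw [norm_sub_sq_real]
  simp only [inner_add_right, real_inner_smul_right, real_inner_self_eq_norm_sq, norm_smul,
    mul_pow, Real.norm_eq_abs, sq_abs]
  rw [real_inner_comm g X]
  field_simp
  ring

/-- Comparison principle: a sub-harmonic that is non-positive outside a compact subset of `G` is
non-positive, provided that `G` carries a strict positive super-harmonic of class `C^2`. -/
theorem IsSubharmonic.nonpos {Ω G K : Set (Euc N)} {μ : ℝ} (hG : IsOpen G)
    (hδ : ∀ x ∈ G, 0 < bdryDist Ω x) {H : Euc N → ℝ} {X : Euc N → Euc N}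
    (hH : ∀ x ∈ G, HasGradientAt H (X x) x) (hX : ContDiffOn ℝ 1 X G)
    (hHpos : ∀ x ∈ G, 0 < H x)
    (hP : ∀ x ∈ G, 0 < -divergence X x - μ / bdryDist Ω x ^ 2 * H x)
    {u : Euc N → ℝ} (hu : IsSubharmonic Ω μ G u) (hK : IsCompact K) (hKG : K ⊆ G)
    (huK : ∀ x ∈ G, x ∉ K → u x ≤ 0) : ∀ x ∈ G, u x ≤ 0 := by
  obtain ⟨hcu, g, hg, hsub⟩ := hu
  have hm := hG.measurableSet
  have hHc : ContinuousOn H G := (contDiffOn_of_hasGradientAt hG hH hX.continuousOn).continuousOn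
  have hne : ∀ x ∈ G, H x ≠ 0 := fun x hx => (hHpos x hx).ne'
  have hq1 : ∀ x ∈ G, HasGradientAt (fun y => 1 / H y) (-(1 / H x ^ 2) • X x) x := fun x hx => by
    have h1 : HasDerivAt (fun s : ℝ => 1 / s) (-(1 / H x ^ 2)) (H x) := by
      simpa using hasDerivAt_inv (hne x hx)
    exact HasGradientAt.scomp h1 (hH x hx)
  have hq2 : ∀ x ∈ G, HasGradientAt (fun y => 1 / H y ^ 2) (-(2 / H x ^ 3) • X x) x := fun x hx => by
    have h0 := hne x hx
    have h1 : HasDerivAt (fun s : ℝ => 1 / s ^ 2) (-(2 / H x ^ 3)) (H x) := by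
      have h2 := (hasDerivAt_pow 2 (H x)).fun_inv (pow_ne_zero 2 h0)
      simp only [one_div]
      refine h2.congr_deriv ?_
      push_cast
      field_simp
    exact HasGradientAt.scomp (f := fun s => 1 / s ^ 2) h1 (hH x hx)
  have hY1 : ContinuousOn (fun x => -(1 / H x ^ 2) • X x) G :=
    ((continuousOn_const.div (hHc.pow 2) fun x hx => pow_ne_zero 2 (hne x hx)).neg).smul
      hX.continuousOn
  have hY2 : ContinuousOn (fun x => -(2 / H x ^ 3) • X x) G :=
    ((continuousOn_const.div (hHc.pow 3) fun x hx => pow_ne_zero 3 (hne x hx)).neg).smul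
      hX.continuousOn
  -- The test functions are `v₁ = u₊²/H` for `u` and `v₂ = u₊³/H²` for `H`, chosen so that `u v₁ = H
  -- v₂`.
  have t1 := memH1Compact_mul_comp hG hK hKG hcu hg huK (contDiff_max_zero_pow 0)
    (fun s hs => ⟨by simp [max_eq_right hs], by rw [deriv_max_zero_pow]; simp [max_eq_right hs]⟩)
    hq1 hY1
  have t2 := memH1Compact_mul_comp hG hK hKG hcu hg huK (contDiff_max_zero_pow 1)
    (fun s hs => ⟨by simp [max_eq_right hs], by rw [deriv_max_zero_pow]; simp [max_eq_right hs]⟩)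
    hq2 hY2
  have f1 := hsub _ _ t1 (by
    filter_upwards [ae_restrict_mem hm] with x hx
    have := hHpos x hx
    positivity)
  obtain ⟨hi, f2⟩ := hardyForm_eq_integral (μ := μ) hG hδ hH hX t2
  obtain ⟨i1, i2⟩ := integrableOn_form (μ := μ) hG hδ hg t1
  obtain ⟨i3, i4⟩ := integrableOn_form (μ := μ) hG hδ
    (memH1Loc_of_hasGradientAt hG hH hX.continuousOn) t2
  unfold hardyForm at f1 f2
  have e1 : ∫ x in G, μ / bdryDist Ω x ^ 2 * u x * (1 / H x * max (u x) 0 ^ (0 + 2))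
      = ∫ x in G, μ / bdryDist Ω x ^ 2 * H x * (1 / H x ^ 2 * max (u x) 0 ^ (1 + 2)) := by
    refine setIntegral_congr_fun hm fun x hx => ?_
    have h0 := hne x hx
    have h2 : u x * max (u x) 0 ^ 2 = max (u x) 0 ^ 3 := by
      rcases le_total (u x) 0 with h | h
      · simp [max_eq_right h]
      · rw [max_eq_left h]; ring
    simp only [zero_add, Nat.reduceAdd, ← h2]
    field_simp
  have e2 := integral_sub i1 i3
  have e3 := integral_nonneg_of_ae (μ := volume.restrict G) (f := fun x =>
      inner ℝ (g x) ((1 / H x) • deriv (fun s => max s 0 ^ (0 + 2)) (u x) • g x +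
          max (u x) 0 ^ (0 + 2) • -(1 / H x ^ 2) • X x)
        - inner ℝ (X x) ((1 / H x ^ 2) • deriv (fun s => max s 0 ^ (1 + 2)) (u x) • g x +
          max (u x) 0 ^ (1 + 2) • -(2 / H x ^ 3) • X x)) (by
    filter_upwards [ae_restrict_mem hm] with x hx
    have h0 := hHpos x hx
    have h1 := inner_test_gradients h0 (t := max (u x) 0) (g x) (X x)
    rw [deriv_max_zero_pow, deriv_max_zero_pow]
    have h2 : 0 ≤ 2 * max (u x) 0 / H x * ‖g x - (max (u x) 0 / H x) • X x‖ ^ 2 := by positivity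
    rw [← h1] at h2
    norm_num at h2 ⊢
    exact h2)
  beta_reduce at f1 f2
  have hnn : 0 ≤ᵐ[volume.restrict G] fun x => 1 / H x ^ 2 * max (u x) 0 ^ (1 + 2)
      * (-divergence X x - μ / bdryDist Ω x ^ 2 * H x) := by
    filter_upwards [ae_restrict_mem hm] with x hx
    have h0 := hHpos x hx
    exact mul_nonneg (by positivity) (hP x hx).le
  -- Subtracting the form of `H` from that of `u` leaves the non-negative square, so the integral of
  -- `v₂` times the operator on `H` is at most the form of `u`, hence at most `0`. Its integrand is
  -- non-negative and vanishes only where `u₊` does.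
  have hzero := (integral_eq_zero_iff_of_nonneg_ae hnn hi).1
    (le_antisymm (by linarith) (integral_nonneg_of_ae hnn))
  refine nonpos_of_ae_nonpos hG hcu ?_
  filter_upwards [hzero, ae_restrict_mem hm] with x hx hxG
  have h0 := hHpos x hxG
  by_contra! hcon
  have h3 : 0 < 1 / H x ^ 2 * max (u x) 0 ^ (1 + 2)
      * (-divergence X x - μ / bdryDist Ω x ^ 2 * H x) := by
    have := hP x hxG
    have : 0 < max (u x) 0 := lt_max_of_lt_left hcon
    positivity
  exact h3.ne' hx

/-! ### Regularity of the distance to the boundary -/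

/-- A point of the complement nearest to `x` lies on the boundary. A nearest boundary point
therefore also minimizes the distance over nearby points of `{φ = 0}`, which lie outside `Ω`; this
is the constraint for the Lagrange multiplier. -/
lemma bdryDist_le_dist {Ω : Set (Euc N)} {x z : Euc N} (hx : x ∈ Ω)
    (hz : z ∉ Ω) : bdryDist Ω x ≤ dist x z := by
  obtain ⟨y, hy, h⟩ := exists_mem_frontier_infDist_compl_eq_dist hx
    (fun h => hz (h ▸ mem_univ z))
  exact (Metric.infDist_le_dist_of_mem hy).trans (h ▸ Metric.infDist_le_dist_of_mem hz)

/-- Lagrange multipliers for the distance to a level set. -/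
lemma exists_eq_sub_smul_gradient {φ : Euc N → ℝ} {x y : Euc N}
    (hφ : HasStrictFDerivAt φ (fderiv ℝ φ y) y) (hne : fderiv ℝ φ y ≠ 0)
    (hmin : ∀ᶠ z in 𝓝 y, φ z = φ y → dist x y ≤ dist x z) : ∃ t : ℝ, x = y - t • gradient φ y := by
  have hf : HasStrictFDerivAt (fun z : Euc N => ‖z - x‖ ^ 2) (2 • innerSL ℝ (y - x)) y := by
    have h1 : HasStrictFDerivAt (fun z : Euc N => z - x) (ContinuousLinearMap.id ℝ (Euc N)) y :=
      (hasStrictFDerivAt_id y).sub_const x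
    exact ((hasStrictFDerivAt_norm_sq (y - x)).comp y h1)
  have hext : IsLocalExtrOn (fun z : Euc N => ‖z - x‖ ^ 2) {z | φ z = φ y} y := by
    left
    refine eventually_nhdsWithin_iff.2 ?_
    filter_upwards [hmin] with z hz hzφ
    have := hz hzφ
    rw [dist_comm x y, dist_comm x z, dist_eq_norm, dist_eq_norm] at this
    exact pow_le_pow_left₀ (norm_nonneg _) this 2
  obtain ⟨a, b, hab, heq⟩ := hext.exists_multipliers_of_hasStrictFDerivAt_1d hφ hf
  have hb : b ≠ 0 := by
    rintro rfl
    have ha : a ≠ 0 := fun h => hab (by simp [h])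
    rw [zero_smul, add_zero, smul_eq_zero] at heq
    exact heq.elim ha hne
  refine ⟨-(a / (2 * b)), ?_⟩
  have hvec : a • gradient φ y + (2 * b) • (y - x) = 0 := by
    apply (InnerProductSpace.toDual ℝ (Euc N)).injective
    rw [map_add, map_smulₛₗ, map_smulₛₗ, map_zero, gradient, LinearIsometryEquiv.apply_symm_apply,
      ← heq]
    ext v
    simp
    ring
  have h2 : y - x = -(a / (2 * b)) • gradient φ y := by
    have h3 : (2 * b) • (y - x) = -(a • gradient φ y) := by
      rw [eq_neg_iff_add_eq_zero, add_comm]; exact hvec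
    have h4 : (2 * b) ≠ 0 := by simpa using hb
    rw [← inv_smul_smul₀ h4 (y - x), h3, smul_neg, smul_smul, neg_smul]
    congr 2
    field_simp
  rw [← h2]; abel

/-- The map `(y, t) ↦ (y - t ∇φ(y), φ(y))`, whose inverse yields the nearest point projection. -/
noncomputable def normalMap (φ : Euc N → ℝ) (p : Euc N × ℝ) : Euc N × ℝ :=
  (p.1 - p.2 • gradient φ p.1, φ p.1)

lemma contDiffAt_gradient {φ : Euc N → ℝ} {y : Euc N} (h : ContDiffAt ℝ 2 φ y) :
    ContDiffAt ℝ 1 (gradient φ) y := by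
  have h1 : ContDiffAt ℝ 1 (fderiv ℝ φ) y := h.fderiv_right (by norm_num)
  exact (InnerProductSpace.toDual ℝ (Euc N)).symm.contDiff.contDiffAt.comp y h1

lemma inner_gradient (φ : Euc N → ℝ) (y v : Euc N) :
    inner ℝ (gradient φ y) v = fderiv ℝ φ y v := by
  rw [gradient, InnerProductSpace.toDual_symm_apply]

lemma gradient_ne_zero {φ : Euc N → ℝ} {y : Euc N} (h : fderiv ℝ φ y ≠ 0) : gradient φ y ≠ 0 := by
  intro h0
  apply h
  ext v
  rw [← inner_gradient, h0]; simp

lemma contDiffAt_normalMap {φ : Euc N → ℝ} {p : Euc N × ℝ} (h : ContDiffAt ℝ 2 φ p.1) :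
    ContDiffAt ℝ 1 (normalMap φ) p := by
  have h1 : ContDiffAt ℝ 1 (fun p : Euc N × ℝ => gradient φ p.1) p :=
    (contDiffAt_gradient h).comp p contDiffAt_fst
  have h2 : ContDiffAt ℝ 1 (fun p : Euc N × ℝ => φ p.1) p :=
    (h.of_le (by norm_num)).comp p contDiffAt_fst
  exact (contDiffAt_fst.sub (contDiffAt_snd.smul h1)).prodMk h2

/-- The differential of `normalMap φ` at `(y, 0)`. -/
noncomputable def normalMapDeriv (φ : Euc N → ℝ) (y : Euc N) : Euc N × ℝ →L[ℝ] Euc N × ℝ :=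
  ((ContinuousLinearMap.fst ℝ (Euc N) ℝ) -
    (ContinuousLinearMap.snd ℝ (Euc N) ℝ).smulRight (gradient φ y)).prod
    ((fderiv ℝ φ y).comp (ContinuousLinearMap.fst ℝ (Euc N) ℝ))

lemma hasFDerivAt_normalMap {φ : Euc N → ℝ} {y : Euc N} (h : ContDiffAt ℝ 2 φ y) :
    HasFDerivAt (normalMap φ) (normalMapDeriv φ y) (y, (0 : ℝ)) := by
  have hg : DifferentiableAt ℝ (gradient φ) y := (contDiffAt_gradient h).differentiableAt one_ne_zero
  have hφ : DifferentiableAt ℝ φ y := h.differentiableAt two_ne_zero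
  have h1 : HasFDerivAt (fun p : Euc N × ℝ => gradient φ p.1)
      ((fderiv ℝ (gradient φ) y).comp (ContinuousLinearMap.fst ℝ (Euc N) ℝ)) (y, (0 : ℝ)) :=
    HasFDerivAt.comp (y, (0 : ℝ)) (f := Prod.fst) hg.hasFDerivAt hasFDerivAt_fst
  have h2 : HasFDerivAt (fun p : Euc N × ℝ => φ p.1)
      ((fderiv ℝ φ y).comp (ContinuousLinearMap.fst ℝ (Euc N) ℝ)) (y, (0 : ℝ)) :=
    HasFDerivAt.comp (y, (0 : ℝ)) (f := Prod.fst) hφ.hasFDerivAt hasFDerivAt_fst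
  have h3 := (hasFDerivAt_fst.sub ((hasFDerivAt_snd (𝕜 := ℝ) (p := (y, (0 : ℝ)))).smul h1)).prodMk h2
  refine h3.congr_fderiv ?_
  ext v <;> simp [normalMapDeriv]

/-- A kernel vector `(v, s)` satisfies `v = s ∇φ` and `∇φ · v = 0`, so `s |∇φ|² = 0`. In finite
dimension injectivity gives the isomorphism that the inverse function theorem needs. -/
lemma normalMapDeriv_injective {φ : Euc N → ℝ} {y : Euc N} (hne : fderiv ℝ φ y ≠ 0) :
    Function.Injective (normalMapDeriv φ y) := by
  rw [injective_iff_map_eq_zero]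
  rintro ⟨v, s⟩ hvs
  simp only [normalMapDeriv, ContinuousLinearMap.prod_apply, Prod.mk_eq_zero] at hvs
  obtain ⟨h1, h2⟩ := hvs
  have h1' : v = s • gradient φ y := by simpa [sub_eq_zero] using h1
  have h2' : inner ℝ (gradient φ y) v = 0 := by rw [inner_gradient]; simpa using h2
  rw [h1', real_inner_smul_right, real_inner_self_eq_norm_sq, mul_eq_zero] at h2'
  have hs : s = 0 := h2'.resolve_right (pow_ne_zero 2 (norm_ne_zero_iff.2 (gradient_ne_zero hne)))
  simp [h1', hs]

/-- The differential of `normalMap φ` at `(y, 0)` as a linear equivalence. -/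
noncomputable def normalMapEquiv (φ : Euc N → ℝ) (y : Euc N) (hne : fderiv ℝ φ y ≠ 0) :
    (Euc N × ℝ) ≃L[ℝ] (Euc N × ℝ) :=
  (LinearEquiv.ofInjectiveEndo (normalMapDeriv φ y : Euc N × ℝ →ₗ[ℝ] Euc N × ℝ)
    (normalMapDeriv_injective hne)).toContinuousLinearEquiv

/-- A left inverse is enough: a nearest point `y` of `x` satisfies `normalMap φ (y, t) = (x, 0)`, so
`Ψ (x, 0)` recovers `y` and `t` as `C^1` functions of `x`. -/
lemma exists_inverse_normalMap {φ : Euc N → ℝ} {y : Euc N} (h : ContDiffAt ℝ 2 φ y)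
    (hne : fderiv ℝ φ y ≠ 0) : ∃ Ψ : Euc N × ℝ → Euc N × ℝ,
      ContDiffAt ℝ 1 Ψ (y, φ y) ∧ Ψ (y, φ y) = (y, 0) ∧
        ∀ᶠ p in 𝓝 (y, (0 : ℝ)), Ψ (normalMap φ p) = p := by
  have hc : ContDiffAt ℝ 1 (normalMap φ) (y, (0 : ℝ)) := contDiffAt_normalMap h
  have hd : HasFDerivAt (normalMap φ) ((normalMapEquiv φ y hne : (Euc N × ℝ) →L[ℝ] (Euc N × ℝ)))
      (y, (0 : ℝ)) := by
    have heq : ((normalMapEquiv φ y hne : (Euc N × ℝ) →L[ℝ] (Euc N × ℝ))) = normalMapDeriv φ y := by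
      ext v <;> rfl
    rw [heq]
    exact hasFDerivAt_normalMap h
  have h0 : normalMap φ (y, 0) = (y, φ y) := by simp [normalMap]
  refine ⟨hc.localInverse hd one_ne_zero, ?_, ?_, ?_⟩
  · rw [← h0]
    exact hc.to_localInverse hd one_ne_zero
  · rw [← h0]
    exact HasStrictFDerivAt.localInverse_apply_image (hc.hasStrictFDerivAt' hd one_ne_zero)
  · exact HasStrictFDerivAt.eventually_left_inverse (hc.hasStrictFDerivAt' hd one_ne_zero)

lemma IsBoundedC2Domain.isCompact_frontier {Ω : Set (Euc N)} (hΩ : IsBoundedC2Domain Ω) :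
    IsCompact (frontier Ω) :=
  hΩ.isBounded.isCompact_closure.of_isClosed_subset isClosed_frontier frontier_subset_closure

lemma IsBoundedC2Domain.nonempty_frontier {Ω : Set (Euc N)} (hΩ : IsBoundedC2Domain Ω)
    (hN : 1 ≤ N) : (frontier Ω).Nonempty := by
  have : Nonempty (Fin N) := ⟨⟨0, hN⟩⟩
  rw [nonempty_frontier_iff]
  refine ⟨hΩ.isConnected.nonempty, fun h => ?_⟩
  exact NormedSpace.unbounded_univ ℝ (Euc N) (h ▸ hΩ.isBounded)

lemma eventually_eq_zero_of_mem_frontier {Ω : Set (Euc N)} (hΩ : IsOpen Ω) {x₀ : Euc N}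
    {φ : Euc N → ℝ} (hφ : ContDiffAt ℝ 2 φ x₀) (h : ∀ᶠ x in 𝓝 x₀, (x ∈ Ω ↔ φ x < 0)) :
    ∀ᶠ y in 𝓝 x₀, y ∈ frontier Ω → φ y = 0 := by
  filter_upwards [h.eventually_nhds, hφ.eventually (by simp)] with y hy hφy hyf
  refine le_antisymm ?_ ?_
  · by_contra! hpos
    have h1 : ∀ᶠ z in 𝓝 y, z ∉ Ω := by
      filter_upwards [hy, hφy.continuousAt.eventually_const_lt hpos] with z hz hz2 hzΩ
      exact lt_asymm (hz.1 hzΩ) hz2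
    have h2 := mem_closure_iff_frequently.1 (frontier_subset_closure hyf)
    exact h2 h1
  · by_contra! hneg
    have hyΩ : y ∈ Ω := hy.self_of_nhds.2 hneg
    rw [frontier, hΩ.interior_eq] at hyf
    exact hyf.2 hyΩ

/-- Near a boundary point of a `C^2` domain the nearest point projection is of class `C^1`. -/
lemma exists_nearest_point {Ω : Set (Euc N)} (hΩ : IsBoundedC2Domain Ω) {x₀ : Euc N}
    (hx₀ : x₀ ∈ frontier Ω) : ∃ (φ : Euc N → ℝ) (Y : Euc N → Euc N) (T : Euc N → ℝ),
      ContDiffAt ℝ 2 φ x₀ ∧ fderiv ℝ φ x₀ ≠ 0 ∧ ContDiffAt ℝ 1 Y x₀ ∧ ContDiffAt ℝ 1 T x₀ ∧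
      Y x₀ = x₀ ∧ ∀ᶠ x in 𝓝 x₀, x ∈ Ω → φ (Y x) = 0 ∧ bdryDist Ω x = ‖x - Y x‖ ∧
        x - Y x = -T x • gradient φ (Y x) := by
  obtain ⟨φ, hφ, hne, hlev⟩ := hΩ.boundary x₀ hx₀
  obtain ⟨Ψ, hΨ, hΨ0, hΨinv⟩ := exists_inverse_normalMap hφ hne
  have hfr := eventually_eq_zero_of_mem_frontier hΩ.isOpen hφ hlev
  have hφ0 : φ x₀ = 0 := hfr.self_of_nhds hx₀
  rw [hφ0] at hΨ hΨ0
  have hι : ContDiffAt ℝ 1 (fun x : Euc N => (x, (0 : ℝ))) x₀ := contDiffAt_id.prodMk contDiffAt_const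
  have hΨx : ContDiffAt ℝ 1 (fun x : Euc N => Ψ (x, 0)) x₀ :=
    ContDiffAt.comp (f := fun x : Euc N => (x, (0 : ℝ))) x₀ hΨ hι
  refine ⟨φ, fun x => (Ψ (x, 0)).1, fun x => (Ψ (x, 0)).2, hφ, hne,
    hΨx.fst, hΨx.snd, by simp [hΨ0], ?_⟩
  -- A lower bound for `|∇φ|` near `x₀`; it turns `|x - y| = |t| |∇φ(y)|` into a bound on `t`.
  set c := ‖gradient φ x₀‖ / 2 with hc
  have hg0 : 0 < ‖gradient φ x₀‖ := norm_pos_iff.2 (gradient_ne_zero hne)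
  have hcpos : 0 < c := by positivity
  have hgood : ∀ᶠ y in 𝓝 x₀, ContDiffAt ℝ 2 φ y ∧ c < ‖gradient φ y‖ ∧
      (∀ᶠ z in 𝓝 y, (z ∈ Ω ↔ φ z < 0)) ∧ (y ∈ frontier Ω → φ y = 0) := by
    have hcont : ContinuousAt (fun y => ‖gradient φ y‖) x₀ :=
      (contDiffAt_gradient hφ).continuousAt.norm
    filter_upwards [hφ.eventually (by simp), hlev.eventually_nhds, hfr,
      hcont.eventually_const_lt (show c < ‖gradient φ x₀‖ by rw [hc]; linarith)]
      with y h1 h2 h3 h4 using ⟨h1, h4, h2, h3⟩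
  obtain ⟨ε₁, hε₁, hb₁⟩ := Metric.eventually_nhds_iff.1 hgood
  obtain ⟨ε₂, hε₂, hb₂⟩ := Metric.eventually_nhds_iff.1 hΨinv
  -- The halves are needed because `|y - x₀| ≤ 2 |x - x₀|` for a nearest point `y`; the bound `c ε₂`
  -- ensures `|t| < ε₂`.
  have hη : 0 < min (ε₁ / 2) (min (ε₂ / 2) (c * ε₂)) := by positivity
  refine Metric.eventually_nhds_iff.2 ⟨_, hη, fun x hx hxΩ => ?_⟩
  obtain ⟨y, hy, hxy⟩ := hΩ.isCompact_frontier.exists_infDist_eq_dist ⟨x₀, hx₀⟩ x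
  have hx1 : dist x x₀ < ε₁ / 2 := hx.trans_le (min_le_left _ _)
  have hx2 : dist x x₀ < ε₂ / 2 := hx.trans_le ((min_le_right _ _).trans (min_le_left _ _))
  have hx3 : dist x x₀ < c * ε₂ := hx.trans_le ((min_le_right _ _).trans (min_le_right _ _))
  have hxy' : dist x y ≤ dist x x₀ := by
    rw [← hxy]; exact Metric.infDist_le_dist_of_mem hx₀
  have hyx₀ : dist y x₀ ≤ dist x y + dist x x₀ := by
    rw [dist_comm x y]; exact dist_triangle _ _ _
  obtain ⟨g1, g2, g3, g4⟩ := hb₁ (show dist y x₀ < ε₁ by linarith)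
  have hφy : φ y = 0 := g4 hy
  have hgy : fderiv ℝ φ y ≠ 0 := by
    intro h0
    rw [gradient, h0, map_zero, norm_zero] at g2
    exact absurd g2 (not_lt.2 hcpos.le)
  obtain ⟨t, ht⟩ := exists_eq_sub_smul_gradient (x := x)
    (g1.hasStrictFDerivAt (by norm_num)) hgy (by
      filter_upwards [g3] with z hz hzφ
      have hzΩ : z ∉ Ω := fun h => by
        have := hz.1 h
        rw [hzφ, hφy] at this
        exact lt_irrefl _ this
      rw [← hxy]
      exact bdryDist_le_dist hxΩ hzΩ)
  have htn : ‖x - y‖ = |t| * ‖gradient φ y‖ := by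
    rw [show x - y = -(t • gradient φ y) by nth_rewrite 1 [ht]; abel, norm_neg, norm_smul,
      Real.norm_eq_abs]
  have htε : |t| < ε₂ := by
    have h1 : |t| * c ≤ ‖x - y‖ := by rw [htn]; gcongr
    rw [← dist_eq_norm] at h1
    have h2 : |t| * c < ε₂ * c := by linarith
    exact lt_of_mul_lt_mul_right h2 hcpos.le
  have hinv := hb₂ (show dist (y, t) (x₀, (0 : ℝ)) < ε₂ by
    rw [Prod.dist_eq, max_lt_iff]
    refine ⟨by linarith, ?_⟩
    simpa [Real.dist_eq] using htε)
  have hnm : normalMap φ (y, t) = (x, 0) := by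
    simp only [normalMap, hφy, ← ht]
  rw [hnm] at hinv
  simp only [hinv]
  refine ⟨hφy, ?_, ?_⟩
  · rw [← dist_eq_norm]; exact hxy
  · nth_rewrite 1 [ht]; rw [neg_smul]; abel

lemma divergence_const_smul {m : Euc N → Euc N} {x : Euc N} (hm : DifferentiableAt ℝ m x) (c : ℝ) :
    divergence (fun z => c • m z) x = c * divergence m x := by
  simp [divergence, fderiv_fun_const_smul hm, Finset.mul_sum]

lemma bdryDist_pos {Ω : Set (Euc N)} (hΩ : IsOpen Ω) (hne : (frontier Ω).Nonempty) {x : Euc N}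
    (hx : x ∈ Ω) : 0 < bdryDist Ω x := by
  refine (isClosed_frontier.notMem_iff_infDist_pos hne).1 fun h => ?_
  rw [frontier, hΩ.interior_eq] at h
  exact h.2 hx

/-- The gradient of the distance in terms of the nearest point projection. -/
lemma hasGradientAt_bdryDist {Ω : Set (Euc N)} {x : Euc N} (hpos : 0 < bdryDist Ω x)
    {φ : Euc N → ℝ} {Y : Euc N → Euc N} {t : ℝ} (hφ : DifferentiableAt ℝ φ (Y x))
    (hY : DifferentiableAt ℝ Y x) (h0 : ∀ᶠ z in 𝓝 x, φ (Y z) = 0)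
    (hd : ∀ᶠ z in 𝓝 x, bdryDist Ω z = ‖z - Y z‖) (ht : x - Y x = t • gradient φ (Y x)) :
    HasGradientAt (bdryDist Ω) ((bdryDist Ω x)⁻¹ • (x - Y x)) x := by
  -- `x - Y x` is normal to the level set in which `Y` takes its values. The derivative of `Y` thus
  -- drops out of that of `|x - Y|²`, so `∇δ` involves only `Y` itself and is as regular as `Y`.
  have horth : ∀ v, inner ℝ (x - Y x) (fderiv ℝ Y x v) = 0 := fun v => by
    have h1 : HasFDerivAt (fun z => φ (Y z)) ((fderiv ℝ φ (Y x)).comp (fderiv ℝ Y x)) x :=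
      hφ.hasFDerivAt.comp x hY.hasFDerivAt
    have h2 : HasFDerivAt (fun z => φ (Y z)) (0 : Euc N →L[ℝ] ℝ) x :=
      (hasFDerivAt_const (0 : ℝ) x).congr_of_eventuallyEq h0
    have h3 := congrArg (fun L : Euc N →L[ℝ] ℝ => L v) (h1.unique h2)
    rw [ht, real_inner_smul_left, inner_gradient]
    simp only [ContinuousLinearMap.comp_apply, zero_apply] at h3
    rw [h3, mul_zero]
  have hx := hd.self_of_nhds
  have hsq := ((hasFDerivAt_id x).sub hY.hasFDerivAt).norm_sq
  have hne : ‖x - Y x‖ ^ 2 ≠ 0 := by rw [← hx]; positivity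
  have hroot := HasFDerivAt.sqrt hsq hne
  rw [hasGradientAt_iff_hasFDerivAt]
  refine (hroot.congr_of_eventuallyEq ?_).congr_fderiv ?_
  · filter_upwards [hd] with z hz
    simp [hz]
  · ext v
    have h4 := horth v
    simp only [inner_sub_left] at h4
    simp [← hx, h4, Real.sqrt_sq hpos.le]
    ring

/-- The properties of the distance to the boundary that are used below: `x` is a point at which it
is of class `C^2`, with gradient of length one and Laplacian bounded by `C`. -/
structure IsRegularPoint (Ω : Set (Euc N)) (C : ℝ) (x : Euc N) : Prop where
  hasGradientAt : HasGradientAt (bdryDist Ω) (gradient (bdryDist Ω) x) x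
  norm_gradient : ‖gradient (bdryDist Ω) x‖ = 1
  contDiffAt_gradient : ContDiffAt ℝ 1 (gradient (bdryDist Ω)) x
  abs_divergence_le : |divergence (gradient (bdryDist Ω)) x| ≤ C

lemma IsRegularPoint.mono {Ω : Set (Euc N)} {C C' : ℝ} {x : Euc N} (h : IsRegularPoint Ω C x)
    (hC : C ≤ C') : IsRegularPoint Ω C' x :=
  ⟨h.1, h.2, h.3, h.4.trans hC⟩

/-- The unit normal `m` at the nearest point is a `C^1` function of `x`, and `∇δ = ± m` with a
locally constant sign. Hence `δ` is of class `C^2`, and its Laplacian `± div m` is bounded near `x₀`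
by continuity of `div m`. -/
lemma exists_eventually_isRegularPoint {Ω : Set (Euc N)} (hΩ : IsBoundedC2Domain Ω) {x₀ : Euc N}
    (hx₀ : x₀ ∈ frontier Ω) : ∃ C, ∀ᶠ x in 𝓝 x₀, x ∈ Ω → IsRegularPoint Ω C x := by
  obtain ⟨φ, Y, T, hφ, hne, hY, hT, hYx₀, hev⟩ := exists_nearest_point hΩ hx₀
  have hgY : ContDiffAt ℝ 1 (fun x => gradient φ (Y x)) x₀ :=
    ContDiffAt.comp (g := gradient φ) x₀ (by rw [hYx₀]; exact contDiffAt_gradient hφ) hY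
  have hgne : gradient φ (Y x₀) ≠ 0 := by rw [hYx₀]; exact gradient_ne_zero hne
  set m : Euc N → Euc N := fun x => ‖gradient φ (Y x)‖⁻¹ • gradient φ (Y x) with hm
  have hmC : ContDiffAt ℝ 1 m x₀ :=
    ((hgY.norm ℝ hgne).inv (norm_ne_zero_iff.2 hgne)).smul hgY
  have hdivc : ContinuousAt (divergence m) x₀ := by
    have h1 : ContinuousAt (fderiv ℝ m) x₀ :=
      (hmC.fderiv_right (m := 0) (by norm_num)).continuousAt
    refine tendsto_finsetSum _ fun i _ => ?_
    have h2 : ContinuousAt (fun x => fderiv ℝ m x (EuclideanSpace.single i 1)) x₀ :=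
      h1.clm_apply continuousAt_const
    exact (EuclideanSpace.proj (𝕜 := ℝ) i).continuous.continuousAt.comp h2
  have hgood : ∀ᶠ x in 𝓝 x₀, ContDiffAt ℝ 1 Y x ∧ ContDiffAt ℝ 1 T x ∧
      DifferentiableAt ℝ φ (Y x) ∧ gradient φ (Y x) ≠ 0 := by
    have h3 : ∀ᶠ y in 𝓝 (Y x₀), ContDiffAt ℝ 2 φ y := by
      rw [hYx₀]; exact hφ.eventually (by simp)
    filter_upwards [hY.eventually (by simp), hT.eventually (by simp),
      hY.continuousAt.eventually h3, hgY.continuousAt.eventually_ne hgne] with x h1 h2 h4 h5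
    exact ⟨h1, h2, h4.differentiableAt two_ne_zero, h5⟩
  refine ⟨|divergence m x₀| + 1, ?_⟩
  filter_upwards [hev.eventually_nhds, hgood.eventually_nhds, hmC.eventually (by simp),
    hdivc.abs.eventually_lt_const (lt_add_one |divergence m x₀|)] with x hx1 hx2 hx3 hx4 hxΩ
  have hΩx : ∀ᶠ z in 𝓝 x, z ∈ Ω := hΩ.isOpen.mem_nhds hxΩ
  have hgrad : ∀ᶠ z in 𝓝 x, HasGradientAt (bdryDist Ω) ((bdryDist Ω z)⁻¹ • (z - Y z)) z := by
    filter_upwards [hx1.eventually_nhds, hx2, hΩx.eventually_nhds] with z hz1 hz2 hz3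
    obtain ⟨hz4, -, hz5, -⟩ := hz2
    refine hasGradientAt_bdryDist (bdryDist_pos hΩ.isOpen ⟨x₀, hx₀⟩ hz3.self_of_nhds) hz5
      (hz4.differentiableAt one_ne_zero) ?_ ?_ (hz1.self_of_nhds hz3.self_of_nhds).2.2
    · filter_upwards [hz1, hz3] with y hy hyΩ using (hy hyΩ).1
    · filter_upwards [hz1, hz3] with y hy hyΩ using (hy hyΩ).2.1
  have hformula : ∀ z ∈ Ω, (φ (Y z) = 0 ∧ bdryDist Ω z = ‖z - Y z‖ ∧
      z - Y z = -T z • gradient φ (Y z)) → T z ≠ 0 ∧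
      (bdryDist Ω z)⁻¹ • (z - Y z) = -(T z / |T z|) • m z := by
    rintro z hz ⟨-, h2, h3⟩
    have hδ := bdryDist_pos hΩ.isOpen ⟨x₀, hx₀⟩ hz
    have h4 : bdryDist Ω z = |T z| * ‖gradient φ (Y z)‖ := by
      rw [h2, h3, norm_smul, norm_neg, Real.norm_eq_abs]
    refine ⟨fun h => ?_, ?_⟩
    · rw [h4, h] at hδ; simp at hδ
    · rw [h4, h3, hm, smul_smul, smul_smul]
      congr 1
      rw [mul_inv]; ring
  have hTx : T x ≠ 0 := (hformula x hxΩ (hx1.self_of_nhds hxΩ)).1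
  -- `T` is continuous and non-zero at `x`, so its sign is constant nearby. The sign may depend on
  -- `x`, since only `|σ| = 1` enters the bound.
  obtain ⟨σ, hσ1, hσ⟩ : ∃ σ : ℝ, |σ| = 1 ∧ ∀ᶠ z in 𝓝 x, -(T z / |T z|) = σ := by
    have hTc : ContinuousAt T x := hx2.self_of_nhds.2.1.continuousAt
    rcases lt_or_gt_of_ne hTx with h | h
    · refine ⟨1, by simp, ?_⟩
      filter_upwards [hTc.eventually_lt_const h] with z hz
      rw [abs_of_neg hz, div_neg, div_self hz.ne, neg_neg]
    · refine ⟨-1, by simp, ?_⟩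
      filter_upwards [hTc.eventually_const_lt h] with z hz
      rw [abs_of_pos hz, div_self hz.ne']
  have heq : gradient (bdryDist Ω) =ᶠ[𝓝 x] fun z => σ • m z := by
    filter_upwards [hgrad, hx1, hΩx, hσ] with z h1 h2 h3 h4
    rw [h1.gradient, (hformula z h3 (h2 h3)).2, h4]
  have hself := hgrad.self_of_nhds
  refine ⟨hself.gradient.symm ▸ hself, ?_, ?_, ?_⟩
  · have hδ := bdryDist_pos hΩ.isOpen ⟨x₀, hx₀⟩ hxΩ
    rw [hself.gradient, norm_smul, ← (hx1.self_of_nhds hxΩ).2.1, norm_inv,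
      Real.norm_of_nonneg hδ.le, inv_mul_cancel₀ hδ.ne']
  · exact (hx3.const_smul σ).congr_of_eventuallyEq heq
  · have h1 : divergence (gradient (bdryDist Ω)) x = σ * divergence m x := by
      rw [← divergence_const_smul (hx3.differentiableAt one_ne_zero)]
      simp only [divergence, heq.fderiv_eq]
    rw [h1, abs_mul, hσ1, one_mul]
    exact hx4.le

/-- The distance to the boundary of a bounded `C^2` domain is of class `C^2` near the boundary. -/
theorem exists_isRegularPoint {Ω : Set (Euc N)} (hΩ : IsBoundedC2Domain Ω) (hN : 1 ≤ N) :
    ∃ ρ C : ℝ, 0 < ρ ∧ 0 ≤ C ∧ ∀ x ∈ parallelSet Ω ρ, IsRegularPoint Ω C x := by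
  have hc := hΩ.isCompact_frontier
  have hne := hΩ.nonempty_frontier hN
  obtain ⟨C, hC⟩ : ∃ C, ∀ᶠ x in 𝓝ˢ (frontier Ω), x ∈ Ω → IsRegularPoint Ω C x := by
    refine hc.induction_on (p := fun s => ∃ C, ∀ᶠ x in 𝓝ˢ s, x ∈ Ω → IsRegularPoint Ω C x)
      ⟨0, by simp⟩ (fun s t hst ⟨C, h⟩ => ⟨C, h.filter_mono (nhdsSet_mono hst)⟩) ?_ ?_
    · rintro s t ⟨C, h⟩ ⟨C', h'⟩
      refine ⟨max C C', ?_⟩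
      rw [nhdsSet_union, eventually_sup]
      exact ⟨h.mono fun x hx hxΩ => (hx hxΩ).mono (le_max_left _ _),
        h'.mono fun x hx hxΩ => (hx hxΩ).mono (le_max_right _ _)⟩
    · intro x hx
      obtain ⟨C, h⟩ := exists_eventually_isRegularPoint hΩ hx
      obtain ⟨U, hU, hUo, hxU⟩ := eventually_nhds_iff.1 h
      refine ⟨U, mem_nhdsWithin_of_mem_nhds (hUo.mem_nhds hxU), C, ?_⟩
      exact mem_of_superset (hUo.mem_nhdsSet.2 Subset.rfl) hU
  obtain ⟨U, hUo, hfU, hU⟩ := mem_nhdsSet_iff_exists.1 hC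
  obtain ⟨ρ, hρ, hρU⟩ := hc.exists_thickening_subset_open hUo hfU
  refine ⟨ρ, max C 0, hρ, le_max_right _ _, fun x hx => ?_⟩
  exact (hU (hρU ((Metric.mem_thickening_iff_infDist_lt hne).2 hx.2)) hx.1).mono (le_max_left _ _)

/-! ### Functions of the distance -/

lemma isOpen_parallelSet {Ω : Set (Euc N)} (hΩ : IsOpen Ω) (ρ : ℝ) : IsOpen (parallelSet Ω ρ) :=
  hΩ.inter (isOpen_Iio.preimage (continuous_bdryDist Ω))

lemma parallelSet_mono {Ω : Set (Euc N)} {ρ ρ' : ℝ} (h : ρ ≤ ρ') :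
    parallelSet Ω ρ ⊆ parallelSet Ω ρ' :=
  fun _ hx => ⟨hx.1, hx.2.trans_le h⟩

/-- The gradient of a function of the distance to the boundary. -/
noncomputable def radialField (Ω : Set (Euc N)) (f' : ℝ → ℝ) (x : Euc N) : Euc N :=
  f' (bdryDist Ω x) • gradient (bdryDist Ω) x

lemma IsRegularPoint.hasGradientAt_comp {Ω : Set (Euc N)} {C : ℝ} {x : Euc N}
    (h : IsRegularPoint Ω C x) {f f' : ℝ → ℝ}
    (hf : HasDerivAt f (f' (bdryDist Ω x)) (bdryDist Ω x)) :
    HasGradientAt (fun y => f (bdryDist Ω y)) (radialField Ω f' x) x :=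
  HasGradientAt.scomp hf h.hasGradientAt

lemma contDiffOn_bdryDist {Ω G : Set (Euc N)} {C : ℝ} (hG : IsOpen G)
    (h : ∀ x ∈ G, IsRegularPoint Ω C x) : ContDiffOn ℝ 1 (bdryDist Ω) G :=
  contDiffOn_of_hasGradientAt hG (fun x hx => (h x hx).hasGradientAt)
    fun x hx => (h x hx).contDiffAt_gradient.continuousAt.continuousWithinAt

lemma contDiffOn_radialField {Ω G : Set (Euc N)} {C : ℝ} (hG : IsOpen G)
    (h : ∀ x ∈ G, IsRegularPoint Ω C x) {f' : ℝ → ℝ}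
    (hf' : ∀ x ∈ G, ContDiffAt ℝ 1 f' (bdryDist Ω x)) : ContDiffOn ℝ 1 (radialField Ω f') G :=
  fun x hx => (((hf' x hx).comp x ((contDiffOn_bdryDist hG h).contDiffAt
    (hG.mem_nhds hx))).smul (h x hx).contDiffAt_gradient).contDiffWithinAt

/-- The product rule gives `f'' |∇δ|² + f' Δδ`, and `|∇δ| = 1`. -/
lemma IsRegularPoint.divergence_radialField {Ω : Set (Euc N)} {C : ℝ} {x : Euc N}
    (h : IsRegularPoint Ω C x) {f' : ℝ → ℝ} {f'' : ℝ} (hf' : HasDerivAt f' f'' (bdryDist Ω x)) :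
    divergence (radialField Ω f') x
      = f'' + f' (bdryDist Ω x) * divergence (gradient (bdryDist Ω)) x := by
  have h1 := hf'.comp_hasFDerivAt x h.hasGradientAt.hasFDerivAt
  have h2 := (h1.smul (h.contDiffAt_gradient.differentiableAt one_ne_zero).hasFDerivAt).fderiv
  have h3 : fderiv ℝ (radialField Ω f') x = _ := h2
  have h4 : ∑ i, gradient (bdryDist Ω) x i * gradient (bdryDist Ω) x i = 1 := by
    have := h.norm_gradient
    rw [EuclideanSpace.norm_eq, Real.sqrt_eq_one] at this
    simpa [sq] using this
  have h5 : ∀ i, inner ℝ (gradient (bdryDist Ω) x) (EuclideanSpace.single i (1 : ℝ))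
      = gradient (bdryDist Ω) x i := fun i => inner_single_one _ i
  simp only [divergence, h3]
  simp only [Function.comp_apply, add_apply, smul_apply,
    ContinuousLinearMap.smulRight_apply, InnerProductSpace.toDual_apply_apply, h5, PiLp.add_apply,
    PiLp.smul_apply, smul_eq_mul, Finset.sum_add_distrib, mul_assoc, ← Finset.mul_sum, h4]
  ring

/-- The pointwise operator on a function of the distance to the boundary. -/
lemma IsRegularPoint.abs_divergence_radialField_sub_le {Ω : Set (Euc N)} {C : ℝ} {x : Euc N}
    (h : IsRegularPoint Ω C x) {f' : ℝ → ℝ} {f'' : ℝ} (hf' : HasDerivAt f' f'' (bdryDist Ω x)) :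
    |divergence (radialField Ω f') x - f''| ≤ C * |f' (bdryDist Ω x)| := by
  rw [h.divergence_radialField hf', add_sub_cancel_left, abs_mul, mul_comm]
  exact mul_le_mul_of_nonneg_right h.abs_divergence_le (abs_nonneg _)

/-! ### Barriers -/

lemma eventually_nhdsGT_iff {p : ℝ → Prop} :
    (∀ᶠ t in 𝓝[>] (0 : ℝ), p t) ↔ ∃ ρ : ℝ, 0 < ρ ∧ ∀ t, 0 < t → t < ρ → p t := by
  rw [(nhdsGT_basis (0 : ℝ)).eventually_iff]
  simp [and_imp]

lemma negMulLog_pos {t : ℝ} (ht : 0 < t) (ht1 : t < 1) : 0 < Real.negMulLog t := by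
  rw [Real.negMulLog]; have := Real.log_neg ht ht1; nlinarith

lemma hasDerivAt_sqrt_negMulLog {t : ℝ} (ht : 0 < t) (ht1 : t < 1) :
    HasDerivAt (fun t => √(Real.negMulLog t)) ((-Real.log t - 1) / (2 * √(Real.negMulLog t))) t := by
  have hpos := negMulLog_pos ht ht1
  exact (Real.hasDerivAt_negMulLog ht.ne').sqrt hpos.ne'

lemma contDiffAt_sqrt_negMulLog_deriv {t : ℝ} (ht : 0 < t) (ht1 : t < 1) :
    ContDiffAt ℝ 1 (fun t => (-Real.log t - 1) / (2 * √(Real.negMulLog t))) t := by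
  have hpos := negMulLog_pos ht ht1
  have hlog : ContDiffAt ℝ 1 Real.log t := Real.contDiffAt_log.2 ht.ne'
  have hp : ContDiffAt ℝ 1 Real.negMulLog t := by
    have : ContDiffAt ℝ 1 (fun t : ℝ => -t * Real.log t) t := contDiffAt_id.neg.mul hlog
    exact this
  refine (hlog.neg.sub contDiffAt_const).div (contDiffAt_const.mul (hp.sqrt hpos.ne')) ?_
  have := Real.sqrt_pos.2 hpos
  positivity

/-- The form of the second derivative separates `-f / (4 t²)`, the Hardy term with the critical
constant, from the strictly negative remainder `-1 / (4 f³)` that gives strictness even for `μ =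
1/4`. -/
lemma hasDerivAt_deriv_sqrt_negMulLog {t : ℝ} (ht : 0 < t) (ht1 : t < 1) :
    HasDerivAt (fun t => (-Real.log t - 1) / (2 * √(Real.negMulLog t)))
      (-(√(Real.negMulLog t) / (4 * t ^ 2)) - 1 / (4 * √(Real.negMulLog t) ^ 3)) t := by
  have hpos := negMulLog_pos ht ht1
  have hs := Real.sqrt_pos.2 hpos
  have h1 : HasDerivAt (fun t => -Real.log t - 1) (-t⁻¹) t :=
    ((Real.hasDerivAt_log ht.ne').neg).sub_const 1
  have h2 := h1.fun_div ((hasDerivAt_sqrt_negMulLog ht ht1).const_mul 2) (by positivity)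
  refine h2.congr_deriv ?_
  have hsq : √(Real.negMulLog t) ^ 2 = -(t * Real.log t) := by
    rw [Real.sq_sqrt hpos.le, Real.negMulLog]; ring
  set s := √(Real.negMulLog t)
  set L := Real.log t
  have hs0 := hs.ne'
  have ht0 := ht.ne'
  field_simp
  rw [show s ^ 4 = t ^ 2 * L ^ 2 by rw [show s ^ 4 = (s ^ 2) ^ 2 by ring, hsq]; ring, hsq]
  ring

lemma tendsto_negMulLog_mul_log : Tendsto (fun t => Real.negMulLog t * (-Real.log t - 1))
    (𝓝[>] 0) (𝓝 0) := by
  have h1 := (tendsto_log_mul_rpow_nhdsGT_zero (r := 1 / 2) (by norm_num)).pow 2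
  have h2 := tendsto_log_mul_rpow_nhdsGT_zero (r := 1) one_pos
  have h3 := h1.add h2
  rw [zero_pow two_ne_zero, add_zero] at h3
  refine h3.congr' ?_
  filter_upwards [self_mem_nhdsWithin] with t ht
  have ht0 : 0 < t := ht
  have : (t ^ (1 / 2 : ℝ)) ^ 2 = t := by
    rw [← Real.sqrt_eq_rpow, Real.sq_sqrt ht0.le]
  rw [mul_pow, this, Real.rpow_one, Real.negMulLog]
  ring

/-- Multiplying by `4 f³` reduces the claim to `2 C f² |log (1/t) - 1| < 1`, whose left side tends
to `0` since `f² = t log (1/t)`. This is how the curvature term is absorbed. -/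
lemma eventually_mul_abs_deriv_lt (C : ℝ) : ∀ᶠ t in 𝓝[>] (0 : ℝ),
    C * |(-Real.log t - 1) / (2 * √(Real.negMulLog t))| < 1 / (4 * √(Real.negMulLog t) ^ 3) := by
  have h1 := (tendsto_negMulLog_mul_log.abs.const_mul (2 * C))
  rw [abs_zero, mul_zero] at h1
  filter_upwards [h1.eventually_lt_const one_pos, self_mem_nhdsWithin,
    Ioo_mem_nhdsGT (one_pos (α := ℝ))] with t ht ht0 ht1
  have hpos := negMulLog_pos ht1.1 ht1.2
  have hs := Real.sqrt_pos.2 hpos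
  rw [abs_mul, abs_of_pos hpos] at ht
  rw [abs_div, abs_of_pos (show 0 < 2 * √(Real.negMulLog t) by positivity), lt_div_iff₀
    (by positivity)]
  refine lt_of_eq_of_lt ?_ ht
  nth_rewrite 3 [← Real.sq_sqrt hpos.le]
  field_simp
  ring

/-- `√(δ log (1 / δ))` is a strict super-harmonic near the boundary when `μ ≤ 1 / 4`. -/
theorem exists_strict_superharmonic {Ω : Set (Euc N)} (hΩ : IsBoundedC2Domain Ω) (hN : 1 ≤ N)
    {μ : ℝ} (hμ : μ ≤ 1 / 4) : ∃ ρ : ℝ, 0 < ρ ∧ ρ < 1 ∧ ∃ X : Euc N → Euc N,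
      (∀ x ∈ parallelSet Ω ρ, HasGradientAt (fun y => √(Real.negMulLog (bdryDist Ω y))) (X x) x) ∧
      ContDiffOn ℝ 1 X (parallelSet Ω ρ) ∧
      (∀ x ∈ parallelSet Ω ρ, 0 < √(Real.negMulLog (bdryDist Ω x))) ∧
      ∀ x ∈ parallelSet Ω ρ,
        0 < -divergence X x - μ / bdryDist Ω x ^ 2 * √(Real.negMulLog (bdryDist Ω x)) := by
  obtain ⟨ρ₀, C, hρ₀, hC, hreg⟩ := exists_isRegularPoint hΩ hN
  obtain ⟨ρ₁, hρ₁, h₁⟩ := eventually_nhdsGT_iff.1 (eventually_mul_abs_deriv_lt C)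
  have hρ : 0 < min ρ₀ (min ρ₁ (1 / 2)) := by positivity
  set ρ := min ρ₀ (min ρ₁ (1 / 2)) with hρdef
  have ha : ρ ≤ ρ₀ := min_le_left _ _
  have hb : ρ ≤ ρ₁ := (min_le_right _ _).trans (min_le_left _ _)
  have hc : ρ ≤ 1 / 2 := (min_le_right _ _).trans (min_le_right _ _)
  have hG := isOpen_parallelSet hΩ.isOpen ρ
  have hreg' : ∀ x ∈ parallelSet Ω ρ, IsRegularPoint Ω C x := fun x hx =>
    hreg x (parallelSet_mono ha hx)
  have hδ : ∀ x ∈ parallelSet Ω ρ, 0 < bdryDist Ω x := fun x hx =>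
    bdryDist_pos hΩ.isOpen (hΩ.nonempty_frontier hN) hx.1
  have hδ1 : ∀ x ∈ parallelSet Ω ρ, bdryDist Ω x < 1 := fun x hx => by
    have := hx.2; linarith
  refine ⟨ρ, hρ, by linarith,
    radialField Ω (fun t => (-Real.log t - 1) / (2 * √(Real.negMulLog t))),
    fun x hx => (hreg' x hx).hasGradientAt_comp
      (f := fun t => √(Real.negMulLog t)) (hasDerivAt_sqrt_negMulLog (hδ x hx) (hδ1 x hx)),
    contDiffOn_radialField hG hreg' fun x hx =>
      contDiffAt_sqrt_negMulLog_deriv (hδ x hx) (hδ1 x hx),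
    fun x hx => Real.sqrt_pos.2 (negMulLog_pos (hδ x hx) (hδ1 x hx)), fun x hx => ?_⟩
  have h2 := (abs_le.1 ((hreg' x hx).abs_divergence_radialField_sub_le
    (hasDerivAt_deriv_sqrt_negMulLog (hδ x hx) (hδ1 x hx)))).2
  have h3 := h₁ _ (hδ x hx) (hx.2.trans_le hb)
  have hs := Real.sqrt_pos.2 (negMulLog_pos (hδ x hx) (hδ1 x hx))
  have ht := hδ x hx
  -- The condition `μ ≤ 1/4` enters here: the potential is compared with the leading term of `-f''`.
  have h4 : μ / bdryDist Ω x ^ 2 * √(Real.negMulLog (bdryDist Ω x))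
      ≤ √(Real.negMulLog (bdryDist Ω x)) / (4 * bdryDist Ω x ^ 2) := by
    rw [div_mul_eq_mul_div, div_le_div_iff₀ (by positivity) (by positivity)]
    have : μ * √(Real.negMulLog (bdryDist Ω x)) ≤ 1 / 4 * √(Real.negMulLog (bdryDist Ω x)) := by
      gcongr
    nlinarith [pow_pos ht 2]
  linarith

/-- `log (1 / δ)` is a super-harmonic near the boundary when `μ < 0`. -/
theorem isPositiveLocalSuperharmonic_neg_log {Ω : Set (Euc N)} (hΩ : IsBoundedC2Domain Ω)
    (hN : 1 ≤ N) {μ : ℝ} (hμ : μ < 0) :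
    IsPositiveLocalSuperharmonic Ω μ (fun x => -Real.log (bdryDist Ω x)) := by
  obtain ⟨ρ₀, C, hρ₀, hC, hreg⟩ := exists_isRegularPoint hΩ hN
  -- As `μ < 0`, this says `|μ| log (1/t) > 1 + C`. The `1` pays for `f'' = 1 / t²`, and `C` for the
  -- curvature term, at most `C / t ≤ C / t²`.
  have hev : ∀ᶠ t in 𝓝[>] (0 : ℝ), Real.log t < (1 + C) / μ :=
    Real.tendsto_log_nhdsGT_zero.eventually_lt_atBot _
  obtain ⟨ρ₁, hρ₁, h₁⟩ := eventually_nhdsGT_iff.1 hev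
  have hρ : 0 < min ρ₀ (min ρ₁ (1 / 2)) := by positivity
  set ρ := min ρ₀ (min ρ₁ (1 / 2)) with hρdef
  have ha : ρ ≤ ρ₀ := min_le_left _ _
  have hb : ρ ≤ ρ₁ := (min_le_right _ _).trans (min_le_left _ _)
  have hc : ρ ≤ 1 / 2 := (min_le_right _ _).trans (min_le_right _ _)
  have hG := isOpen_parallelSet hΩ.isOpen ρ
  have hreg' : ∀ x ∈ parallelSet Ω ρ, IsRegularPoint Ω C x := fun x hx =>
    hreg x (parallelSet_mono ha hx)
  have hδ : ∀ x ∈ parallelSet Ω ρ, 0 < bdryDist Ω x := fun x hx =>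
    bdryDist_pos hΩ.isOpen (hΩ.nonempty_frontier hN) hx.1
  have hδ1 : ∀ x ∈ parallelSet Ω ρ, bdryDist Ω x < 1 := fun x hx => by
    have := hx.2; linarith
  have hd2 : ∀ t : ℝ, 0 < t → HasDerivAt (fun t : ℝ => -t⁻¹) (1 / t ^ 2) t := fun t ht => by
    exact (hasDerivAt_inv ht.ne').fun_neg.congr_deriv (by simp)
  refine ⟨ρ, hρ, isSuperharmonic_of_hasGradientAt hG hδ (X := radialField Ω (fun t => -t⁻¹))
    (fun x hx => (hreg' x hx).hasGradientAt_comp (f := fun t => -Real.log t)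
      ((Real.hasDerivAt_log (hδ x hx).ne').neg))
    (contDiffOn_radialField hG hreg' fun x hx => (contDiffAt_inv ℝ (hδ x hx).ne').neg) ?_,
    fun x hx => by linarith [Real.log_neg (hδ x hx) (hδ1 x hx)]⟩
  intro x hx
  have h2 := (abs_le.1 ((hreg' x hx).abs_divergence_radialField_sub_le (hd2 _ (hδ x hx)))).2
  have h3 := h₁ _ (hδ x hx) (hx.2.trans_le hb)
  have ht := hδ x hx
  have ht1 := hδ1 x hx
  set t := bdryDist Ω x
  rw [abs_neg, abs_of_pos (inv_pos.2 ht)] at h2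
  rw [lt_div_iff_of_neg hμ] at h3
  have h4 : C * t⁻¹ ≤ C / t ^ 2 := by
    rw [← div_eq_mul_inv, div_le_div_iff₀ ht (by positivity)]
    have : t ^ 2 ≤ t := by nlinarith
    gcongr
  have h5 : μ / t ^ 2 * -Real.log t = -(Real.log t * μ / t ^ 2) := by ring
  have h6 : (1 + C) / t ^ 2 ≤ Real.log t * μ / t ^ 2 := by gcongr
  rw [add_div] at h6
  linarith

/-- `δ ^ μ` is a sub-harmonic near the boundary when `μ > 0`. -/
theorem isLocalSubharmonic_rpow {Ω : Set (Euc N)} (hΩ : IsBoundedC2Domain Ω)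
    (hN : 1 ≤ N) {μ : ℝ} (hμ : 0 < μ) :
    IsLocalSubharmonic Ω μ (fun x => bdryDist Ω x ^ μ) := by
  obtain ⟨ρ₀, C, hρ₀, hC, hreg⟩ := exists_isRegularPoint hΩ hN
  -- For `f = t^μ` one has `-f'' - μ f / t² = -μ² t^(μ - 2)`. This beats the curvature term `C μ
  -- t^(μ - 1)` once `C t ≤ μ`; using `C + 1` avoids a zero denominator.
  have hρ : 0 < min ρ₀ (μ / (C + 1)) := by positivity
  set ρ := min ρ₀ (μ / (C + 1)) with hρdef
  have ha : ρ ≤ ρ₀ := min_le_left _ _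
  have hb : ρ ≤ μ / (C + 1) := min_le_right _ _
  have hG := isOpen_parallelSet hΩ.isOpen ρ
  have hreg' : ∀ x ∈ parallelSet Ω ρ, IsRegularPoint Ω C x := fun x hx =>
    hreg x (parallelSet_mono ha hx)
  have hδ : ∀ x ∈ parallelSet Ω ρ, 0 < bdryDist Ω x := fun x hx =>
    bdryDist_pos hΩ.isOpen (hΩ.nonempty_frontier hN) hx.1
  refine ⟨ρ, hρ, isSubharmonic_of_hasGradientAt hG hδ
    (X := radialField Ω (fun t => μ * t ^ (μ - 1)))
    (fun x hx => (hreg' x hx).hasGradientAt_comp (f := fun t => t ^ μ)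
      (Real.hasDerivAt_rpow_const (Or.inl (hδ x hx).ne')))
    (contDiffOn_radialField hG hreg' fun x hx =>
      contDiffAt_const.mul (Real.contDiffAt_rpow_const_of_ne (hδ x hx).ne')) ?_⟩
  intro x hx
  have ht := hδ x hx
  have hd2 : HasDerivAt (fun t : ℝ => μ * t ^ (μ - 1))
      (μ * ((μ - 1) * bdryDist Ω x ^ (μ - 1 - 1))) (bdryDist Ω x) :=
    (Real.hasDerivAt_rpow_const (Or.inl ht.ne')).const_mul μ
  have h2 := (abs_le.1 ((hreg' x hx).abs_divergence_radialField_sub_le hd2)).1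
  have h3 : C * bdryDist Ω x ≤ μ := by
    have h4 := (le_div_iff₀ (by positivity)).1 (hx.2.le.trans hb)
    nlinarith
  set t := bdryDist Ω x
  have e1 : t ^ (μ - 1) = t * t ^ (μ - 1 - 1) := by
    rw [Real.rpow_sub_one ht.ne' (μ - 1)]; field_simp
  have e2 : t ^ μ = t ^ 2 * t ^ (μ - 1 - 1) := by
    rw [Real.rpow_sub_one ht.ne' (μ - 1), Real.rpow_sub_one ht.ne' μ]; field_simp
  have hw : 0 < t ^ (μ - 1 - 1) := Real.rpow_pos_of_pos ht _
  rw [e2]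
  rw [abs_of_pos (by positivity), e1] at h2
  have e3 : μ / t ^ 2 * (t ^ 2 * t ^ (μ - 1 - 1)) = μ * t ^ (μ - 1 - 1) := by field_simp
  rw [e3]
  have h5 : (C * t) * (μ * t ^ (μ - 1 - 1)) ≤ μ * (μ * t ^ (μ - 1 - 1)) := by gcongr
  nlinarith

/-! ### Behaviour at the boundary and the Phragmén–Lindelöf principle -/

lemma eventually_toBoundary {Ω : Set (Euc N)} {p : Euc N → Prop} :
    (∀ᶠ x in toBoundary Ω, p x) ↔ ∃ ρ : ℝ, 0 < ρ ∧ ∀ x ∈ parallelSet Ω ρ, p x := by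
  rw [toBoundary, eventually_inf_principal, (Metric.nhds_basis_ball.comap _).eventually_iff]
  have habs : ∀ x, |bdryDist Ω x| = bdryDist Ω x := fun x => abs_of_nonneg Metric.infDist_nonneg
  refine exists_congr fun ρ => and_congr_right fun _ => ⟨fun h x hx => h ?_ hx.1, fun h x hx hxΩ => ?_⟩
  · simpa [habs] using hx.2
  · exact h x ⟨hxΩ, by simpa [habs] using hx⟩

lemma isCompact_band {Ω : Set (Euc N)} (hΩ : IsBoundedC2Domain Ω) {a b : ℝ} (ha : 0 < a) :
    IsCompact {x | x ∈ Ω ∧ a ≤ bdryDist Ω x ∧ bdryDist Ω x ≤ b} := by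
  have heq : {x | x ∈ Ω ∧ a ≤ bdryDist Ω x ∧ bdryDist Ω x ≤ b}
      = closure Ω ∩ bdryDist Ω ⁻¹' Icc a b := by
    ext x
    refine ⟨fun h => ⟨subset_closure h.1, h.2⟩, fun h => ⟨by_contra fun hx => ?_, h.2⟩⟩
    have hf : x ∈ frontier Ω := ⟨h.1, fun hi => hx (interior_subset hi)⟩
    have h0 : bdryDist Ω x = 0 := Metric.infDist_zero_of_mem hf
    exact (ha.trans_le h.2.1).ne' h0
  rw [heq]
  exact hΩ.isBounded.isCompact_closure.inter_right (isClosed_Icc.preimage (continuous_bdryDist Ω))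

/-- Phragmén–Lindelöf principle: a local sub-harmonic that is small with respect to some positive
local super-harmonic is bounded by a multiple of `√(δ log (1 / δ))`. -/
theorem le_mul_sqrt_negMulLog {Ω : Set (Euc N)} (hΩ : IsBoundedC2Domain Ω) (hN : 1 ≤ N)
    {μ : ℝ} (hμ : μ ≤ 1 / 4) {u h : Euc N → ℝ} (hu : IsLocalSubharmonic Ω μ u)
    (hh : IsPositiveLocalSuperharmonic Ω μ h)
    (huh : ∀ ε : ℝ, 0 < ε → ∀ᶠ x in toBoundary Ω, u x ≤ ε * h x) :
    ∃ ρ C : ℝ, 0 < ρ ∧ 0 ≤ C ∧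
      ∀ x ∈ parallelSet Ω ρ, u x ≤ C * √(Real.negMulLog (bdryDist Ω x)) := by
  obtain ⟨ρ₁, hρ₁, hu⟩ := hu
  obtain ⟨ρ₂, hρ₂, hh, hhpos⟩ := hh
  obtain ⟨ρ₃, hρ₃, -, X, hX, hXd, hHpos, hP⟩ := exists_strict_superharmonic hΩ hN hμ
  set H : Euc N → ℝ := fun x => √(Real.negMulLog (bdryDist Ω x)) with hH
  -- The factor `2` keeps the closed band up to `δ = r` inside all three parallel sets.
  obtain ⟨r, hr, h1, h2, h3⟩ : ∃ r : ℝ, 0 < r ∧ 2 * r ≤ ρ₁ ∧ 2 * r ≤ ρ₂ ∧ 2 * r ≤ ρ₃ := by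
    have hm : 0 < min ρ₁ (min ρ₂ ρ₃) := by positivity
    refine ⟨min ρ₁ (min ρ₂ ρ₃) / 2, by positivity, ?_, ?_, ?_⟩
    · linarith [min_le_left ρ₁ (min ρ₂ ρ₃)]
    · linarith [(min_le_right ρ₁ (min ρ₂ ρ₃)).trans (min_le_left _ _)]
    · linarith [(min_le_right ρ₁ (min ρ₂ ρ₃)).trans (min_le_right _ _)]
  have hopen := isOpen_parallelSet hΩ.isOpen
  have hδ : ∀ x ∈ Ω, 0 < bdryDist Ω x := fun x hx =>
    bdryDist_pos hΩ.isOpen (hΩ.nonempty_frontier hN) hx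
  have s1 : parallelSet Ω r ⊆ parallelSet Ω ρ₁ := parallelSet_mono (by linarith)
  have s2 : parallelSet Ω r ⊆ parallelSet Ω ρ₂ := parallelSet_mono (by linarith)
  have s3 : parallelSet Ω r ⊆ parallelSet Ω ρ₃ := parallelSet_mono (by linarith)
  have hHc : ContinuousOn H (parallelSet Ω ρ₃) :=
    (contDiffOn_of_hasGradientAt (hopen ρ₃) hX hXd.continuousOn).continuousOn
  set B := {x | x ∈ Ω ∧ r / 2 ≤ bdryDist Ω x ∧ bdryDist Ω x ≤ r} with hBdef
  have hB : IsCompact B := isCompact_band hΩ (by positivity)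
  have hBsub : ∀ {ρ : ℝ}, 2 * r ≤ ρ → B ⊆ parallelSet Ω ρ := fun hρ x hx =>
    ⟨hx.1, by have := hx.2.2; linarith⟩
  -- `C` bounds `u / H` on the compact band `r/2 ≤ δ ≤ r`. It is independent of `ε`, which allows `ε
  -- → 0` at the end.
  obtain ⟨C, hC⟩ := hB.exists_bound_of_continuousOn
    ((hu.1.mono (hBsub h1)).div (hHc.mono (hBsub h3)) fun x hx => (hHpos x (hBsub h3 hx)).ne')
  refine ⟨r, max C 0, hr, le_max_right _ _, fun x hx => ?_⟩
  have hBC : ∀ x ∈ B, u x ≤ max C 0 * H x := fun x hx => by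
    have hp := hHpos x (hBsub h3 hx)
    rw [← div_le_iff₀ hp]
    exact (le_abs_self _).trans ((hC x hx).trans (le_max_left _ _))
  have hδr : ∀ ρ, ∀ x ∈ parallelSet Ω ρ, 0 < bdryDist Ω x := fun ρ x hx => hδ x hx.1
  have hHsup : IsSuperharmonic Ω μ (parallelSet Ω ρ₃) H :=
    isSuperharmonic_of_hasGradientAt (hopen ρ₃) (hδr ρ₃) hX hXd fun x hx => (hP x hx).le
  have key : ∀ ε : ℝ, 0 < ε → u x - max C 0 * H x ≤ ε * h x := by
    intro ε hε
    obtain ⟨σ, hσ, hσu⟩ := eventually_toBoundary.1 (huh ε hε)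
    have hw := ((hu.mono (hopen ρ₁) (hopen r) s1).sub_smul (hopen r) (hδr r)
      (hHsup.mono (hopen ρ₃) (hopen r) s3) (le_max_right C 0)).sub_smul (hopen r) (hδr r)
      (hh.mono (hopen ρ₂) (hopen r) s2) hε.le
    -- Off this compact set, either `δ < σ` and `u ≤ ε h`, or `δ ≥ r/2` and `u ≤ C H`; in both cases
    -- `u - C H - ε h ≤ 0`.
    have hK := isCompact_band (b := r / 2) hΩ hσ
    have := hw.nonpos (hopen r) (hδr r) (fun y hy => hX y (s3 hy)) (hXd.mono s3)
      (fun y hy => hHpos y (s3 hy)) (fun y hy => hP y (s3 hy)) hK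
      (fun y hy => ⟨hy.1, by have := hy.2.2; linarith⟩) (fun y hy hyK => ?_) x hx
    · linarith
    · have hHy := hHpos y (s3 hy)
      have hhy := hhpos y (s2 hy)
      rcases lt_or_ge (bdryDist Ω y) σ with h4 | h4
      · have h5 := hσu y ⟨hy.1, h4⟩
        have h6 := mul_nonneg (le_max_right C 0) hHy.le
        linarith
      · have h5 : r / 2 ≤ bdryDist Ω y := by
          by_contra! h6
          exact hyK ⟨hy.1, h4, h6.le⟩
        have h6 := hBC y ⟨hy.1, h5, hy.2.le⟩
        have h7 := mul_pos hε hhy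
        linarith
  have hhx := hhpos x (s2 hx)
  have : u x - max C 0 * H x ≤ 0 := by
    refine le_of_forall_pos_le_add fun ε hε => ?_
    have := key (ε / h x) (by positivity)
    rw [div_mul_cancel₀ _ hhx.ne'] at this
    linarith
  linarith

/-- If the upper limit of `u / h` is not positive, then `u ≤ ε h` near the boundary. -/
lemma eventually_le_mul_of_limsup_nonpos {Ω : Set (Euc N)} {μ : ℝ} {u h : Euc N → ℝ}
    (hh : IsPositiveLocalSuperharmonic Ω μ h)
    (hlim : ¬ (0 : EReal) < limsup (fun x => ((u x / h x : ℝ) : EReal)) (toBoundary Ω))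
    {ε : ℝ} (hε : 0 < ε) : ∀ᶠ x in toBoundary Ω, u x ≤ ε * h x := by
  obtain ⟨ρ, hρ, -, hpos⟩ := hh
  have h1 : limsup (fun x => ((u x / h x : ℝ) : EReal)) (toBoundary Ω) < (ε : EReal) :=
    (not_lt.1 hlim).trans_lt (by exact_mod_cast hε)
  filter_upwards [eventually_lt_of_limsup_lt h1, eventually_toBoundary.2 ⟨ρ, hρ, hpos⟩] with x hx hx2
  rw [← div_le_iff₀ hx2]
  exact (EReal.coe_lt_coe_iff.1 hx).le

lemma tendsto_bdryDist {Ω : Set (Euc N)} (hΩ : IsBoundedC2Domain Ω) (hN : 1 ≤ N) {x₀ : Euc N}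
    (hx₀ : x₀ ∈ frontier Ω) : Tendsto (bdryDist Ω) (𝓝[Ω] x₀) (𝓝[>] 0) := by
  refine tendsto_nhdsWithin_iff.2 ⟨?_, ?_⟩
  · have := (continuous_bdryDist Ω).continuousAt (x := x₀)
    rw [ContinuousAt, show bdryDist Ω x₀ = 0 from Metric.infDist_zero_of_mem hx₀] at this
    exact this.mono_left nhdsWithin_le_nhds
  · filter_upwards [self_mem_nhdsWithin] with x hx
      using bdryDist_pos hΩ.isOpen (hΩ.nonempty_frontier hN) hx

lemma eventually_mem_parallelSet {Ω : Set (Euc N)} (hΩ : IsBoundedC2Domain Ω) (hN : 1 ≤ N)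
    {x₀ : Euc N} (hx₀ : x₀ ∈ frontier Ω) {ρ : ℝ} (hρ : 0 < ρ) :
    ∀ᶠ x in 𝓝[Ω] x₀, x ∈ parallelSet Ω ρ := by
  filter_upwards [self_mem_nhdsWithin, ((tendsto_bdryDist hΩ hN hx₀).mono_right
    nhdsWithin_le_nhds).eventually_lt_const hρ] with x hx hx2 using ⟨hx, hx2⟩

/-- A finite upper limit bounds `u` above near each boundary point, and compactness of the boundary
makes the bound uniform in a parallel set. -/
lemma exists_le_of_limsup_ne_top {Ω : Set (Euc N)} (hΩ : IsBoundedC2Domain Ω) (hN : 1 ≤ N)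
    {u : Euc N → ℝ} (h : ∀ x₀ ∈ frontier Ω, limsup (fun x => (u x : EReal)) (𝓝[Ω] x₀) ≠ ⊤) :
    ∃ ρ M : ℝ, 0 < ρ ∧ ∀ x ∈ parallelSet Ω ρ, u x ≤ M := by
  have hc := hΩ.isCompact_frontier
  obtain ⟨M, hM⟩ : ∃ M : ℝ, ∀ᶠ x in 𝓝ˢ (frontier Ω), x ∈ Ω → u x ≤ M := by
    refine hc.induction_on (p := fun s => ∃ M : ℝ, ∀ᶠ x in 𝓝ˢ s, x ∈ Ω → u x ≤ M)
      ⟨0, by simp⟩ (fun s t hst ⟨C, h⟩ => ⟨C, h.filter_mono (nhdsSet_mono hst)⟩) ?_ ?_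
    · rintro s t ⟨C, h⟩ ⟨C', h'⟩
      refine ⟨max C C', ?_⟩
      rw [nhdsSet_union, eventually_sup]
      exact ⟨h.mono fun x hx hxΩ => (hx hxΩ).trans (le_max_left _ _),
        h'.mono fun x hx hxΩ => (hx hxΩ).trans (le_max_right _ _)⟩
    · intro x hx
      obtain ⟨M, hM⟩ := EReal.lt_iff_exists_real_btwn.1 (lt_top_iff_ne_top.2 (h x hx))
      have h1 := eventually_nhdsWithin_iff.1 (eventually_lt_of_limsup_lt hM.1)
      obtain ⟨U, hU, hUo, hxU⟩ := eventually_nhds_iff.1 h1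
      refine ⟨U, mem_nhdsWithin_of_mem_nhds (hUo.mem_nhds hxU), M, ?_⟩
      exact mem_of_superset (hUo.mem_nhdsSet.2 Subset.rfl) fun y hy hyΩ =>
        (EReal.coe_lt_coe_iff.1 (hU y hy hyΩ)).le
  obtain ⟨U, hUo, hfU, hU⟩ := mem_nhdsSet_iff_exists.1 hM
  obtain ⟨ρ, hρ, hρU⟩ := hc.exists_thickening_subset_open hUo hfU
  exact ⟨ρ, M, hρ, fun x hx => hU (hρU
    ((Metric.mem_thickening_iff_infDist_lt (hΩ.nonempty_frontier hN)).2 hx.2)) hx.1⟩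

/-- After squaring and dividing by `t^(2μ)` the claim is `C² t^(1 - 2μ) log (1/t) < 1`, which holds
near `0` because `μ < 1/2`. -/
lemma eventually_mul_sqrt_negMulLog_lt_rpow {μ : ℝ} (hμ : μ ≤ 1 / 4) (C : ℝ) :
    ∀ᶠ t in 𝓝[>] (0 : ℝ), C * √(Real.negMulLog t) < t ^ μ := by
  have h1 := (tendsto_log_mul_rpow_nhdsGT_zero (r := 1 - 2 * μ) (by linarith)).const_mul (-C ^ 2)
  rw [mul_zero] at h1
  filter_upwards [h1.eventually_lt_const one_pos, Ioo_mem_nhdsGT (one_pos (α := ℝ))] with t ht ht1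
  have hpos := negMulLog_pos ht1.1 ht1.2
  have hw := Real.rpow_pos_of_pos ht1.1 μ
  refine lt_of_pow_lt_pow_left₀ 2 hw.le ?_
  rw [mul_pow, Real.sq_sqrt hpos.le, Real.negMulLog]
  have e1 : t = (t ^ μ) ^ 2 * t ^ (1 - 2 * μ) := by
    rw [← Real.rpow_natCast, ← Real.rpow_mul ht1.1.le, ← Real.rpow_add ht1.1]
    have : μ * ((2 : ℕ) : ℝ) + (1 - 2 * μ) = 1 := by push_cast; ring
    rw [this, Real.rpow_one]
  calc C ^ 2 * (-t * Real.log t)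
      = (t ^ μ) ^ 2 * (-C ^ 2 * (Real.log t * t ^ (1 - 2 * μ))) := by
        nth_rewrite 1 [e1]; ring
    _ < (t ^ μ) ^ 2 * 1 := by gcongr
    _ = (t ^ μ) ^ 2 := mul_one _

end

/-! ### The theorem -/

theorem corollary2p9 (N : ℕ) (hN : 2 ≤ N) (Ω : Set (EuclideanSpace ℝ (Fin N)))
    (hΩ : IsBoundedC2Domain Ω) (μ : ℝ) (hμ : μ ≤ 1 / 4) :
    (∀ u : EuclideanSpace ℝ (Fin N) → ℝ, IsSmallSubharmonic Ω μ u →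
      VanishesOnBoundary Ω (fun x => max (u x) 0) ∧
      ((∃ ρ : ℝ, 0 < ρ ∧ ∀ x ∈ parallelSet Ω ρ, 0 ≤ u x) → VanishesOnBoundary Ω u)) ∧
    (μ < 0 → ∀ u : EuclideanSpace ℝ (Fin N) → ℝ, IsLargeSubharmonic Ω μ u →
      ∃ x₀ ∈ frontier Ω, limsup (fun x => (u x : EReal)) (𝓝[Ω] x₀) = ⊤) ∧
    (0 < μ → ∃ u : EuclideanSpace ℝ (Fin N) → ℝ,
      IsLargeSubharmonic Ω μ u ∧ IsLocallyPositive Ω u ∧ VanishesOnBoundary Ω u) := by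
  have hN1 : 1 ≤ N := by omega
  refine ⟨fun u hu => ?_, fun hμ0 u hu => ?_, fun hμ0 => ?_⟩
  · obtain ⟨hsub, hsmall⟩ := hu
    have hex : ∃ h, IsPositiveLocalSuperharmonic Ω μ h ∧
        ¬ (0 : EReal) < limsup (fun x => ((u x / h x : ℝ) : EReal)) (toBoundary Ω) := by
      by_contra! hcon
      exact hsmall ⟨hsub, hcon⟩
    obtain ⟨h, hh, hlim⟩ := hex
    obtain ⟨ρ, C, hρ, hC, hle⟩ := le_mul_sqrt_negMulLog hΩ hN1 hμ hsub hh
      fun ε hε => eventually_le_mul_of_limsup_nonpos hh hlim hε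
    have hvan : VanishesOnBoundary Ω (fun x => max (u x) 0) := by
      intro x₀ hx₀
      have hF : Tendsto (fun x => C * √(Real.negMulLog (bdryDist Ω x))) (𝓝[Ω] x₀) (𝓝 0) := by
        have hcont : Continuous fun t => C * √(Real.negMulLog t) :=
          continuous_const.mul Real.continuous_negMulLog.sqrt
        -- `negMulLog` is continuous at `0` with value `0`, so the bound tends to `0` at the
        -- boundary.
        have := (hcont.tendsto 0).comp
          ((tendsto_bdryDist hΩ hN1 hx₀).mono_right nhdsWithin_le_nhds)
        simpa [Function.comp_def] using this
      refine squeeze_zero' (Eventually.of_forall fun x => le_max_right _ _) ?_ hF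
      filter_upwards [eventually_mem_parallelSet hΩ hN1 hx₀ hρ] with x hx
      exact max_le (hle x hx) (by positivity)
    refine ⟨hvan, fun ⟨σ, hσ, hpos⟩ x₀ hx₀ => (hvan x₀ hx₀).congr' ?_⟩
    filter_upwards [eventually_mem_parallelSet hΩ hN1 hx₀ hσ] with x hx
    exact max_eq_left (hpos x hx)
  · by_contra! hcon
    obtain ⟨ρ, M, hρ, hM⟩ := exists_le_of_limsup_ne_top hΩ hN1 hcon
    have hlarge := hu.2 _ (isPositiveLocalSuperharmonic_neg_log hΩ hN1 hμ0)
    refine absurd hlarge (not_lt.2 ?_)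
    refine le_of_forall_gt_imp_ge_of_dense fun ε hε => ?_
    obtain ⟨ε', hε0, hε'⟩ := EReal.lt_iff_exists_real_btwn.1 hε
    have hε'0 : 0 < ε' := by exact_mod_cast hε0
    refine le_trans (limsup_le_of_le (h := ?_)) hε'.le
    -- The first threshold gives `M < ε' log (1/δ)`, so that `u ≤ M` yields `u / h ≤ ε'` for `h =
    -- log (1/δ)`; the second makes the denominator positive.
    have hlog : ∀ᶠ t in 𝓝[>] (0 : ℝ), Real.log t < min (-(M / ε')) (-1) :=
      Real.tendsto_log_nhdsGT_zero.eventually_lt_atBot _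
    obtain ⟨σ, hσ, hσlog⟩ := eventually_nhdsGT_iff.1 hlog
    refine eventually_toBoundary.2 ⟨min ρ σ, lt_min hρ hσ, fun x hx => ?_⟩
    have h1 := hM x (parallelSet_mono (min_le_left _ _) hx)
    have h2 := lt_min_iff.1 (hσlog _ (bdryDist_pos hΩ.isOpen (hΩ.nonempty_frontier hN1) hx.1)
      (hx.2.trans_le (min_le_right _ _)))
    refine EReal.coe_le_coe_iff.2 ?_
    rw [div_le_iff₀ (by linarith [h2.2])]
    have h3 : M / ε' < -Real.log (bdryDist Ω x) := by linarith [h2.1]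
    rw [div_lt_iff₀ hε'0] at h3
    linarith
  · have hsub := isLocalSubharmonic_rpow hΩ hN1 hμ0
    refine ⟨_, ⟨hsub, fun h hh => ?_⟩, ⟨1, one_pos, fun x hx => Real.rpow_pos_of_pos
      (bdryDist_pos hΩ.isOpen (hΩ.nonempty_frontier hN1) hx.1) μ⟩, fun x₀ hx₀ => ?_⟩
    · by_contra hlim
      -- If largeness fails for some `h`, then `δ^μ ≤ C √(δ log (1/δ))` near the boundary,
      -- contradicting the reverse strict inequality at points of `Ω` close to some `x₀` of the
      -- boundary.
      obtain ⟨ρ, C, hρ, hC, hle⟩ := le_mul_sqrt_negMulLog hΩ hN1 hμ hsub hh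
        fun ε hε => eventually_le_mul_of_limsup_nonpos hh hlim hε
      obtain ⟨x₀, hx₀⟩ := hΩ.nonempty_frontier hN1
      have : (𝓝[Ω] x₀).NeBot :=
        mem_closure_iff_nhdsWithin_neBot.1 (frontier_subset_closure hx₀)
      obtain ⟨x, hx1, hx2⟩ := ((eventually_mem_parallelSet hΩ hN1 hx₀ hρ).and
        ((tendsto_bdryDist hΩ hN1 hx₀).eventually
          (eventually_mul_sqrt_negMulLog_lt_rpow hμ C))).exists
      exact absurd (hle x hx1) (not_le.2 hx2)
    · have hcont : ContinuousAt (fun t : ℝ => t ^ μ) 0 :=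
        Real.continuousAt_rpow_const 0 μ (Or.inr hμ0.le)
      have := hcont.tendsto.comp ((tendsto_bdryDist hΩ hN1 hx₀).mono_right nhdsWithin_le_nhds)
      simpa [Real.zero_rpow hμ0.ne', Function.comp_def] using this
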